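/- Let $R,S$ be abelian groups, and let $H^p(-;R)$, $p\in\mathbb Z$, denote singular cohomology (zero for $p<0$). A *stable cohomology operation* $\mu:H^*(-;R)\to H^{*+k}(-;S)$ of degree $k\in\mathbb Z$ is a family of natural transformations $\mu:H^p(-;R)\to H^{p+k}(-;S)$, $p\in\mathbb Z$, of set-valued functors on topological spaces which commutes with the suspension isomorphisms $\tilde H^p(Z)\cong\tilde H^{p+1}(\Sigma Z)$ of all pointed spaces $Z$ ($\Sigma Z$ being the unreduced suspension). Its *excess* is $e(\mu)=\max\{l \mid \mu(u)=0 \text{ for all spaces } Z \text{ and all } u\in H^l(Z;R)\}+1$ (with $e(\mu)=\infty$ if there is no largest such $l$, and $e(\mu)=0$ if there is no such $l\ge 0$). The *genus* of a continuous map $p:E\to B$ is the least $k$ such that $B$ is covered by $k$ open sets on each of which $p$ has a continuous section ($\infty$ if there is none). The *weight* $\mathrm{wgt}_p(u)$ of a class $u\in H^q(B;G)$ with respect to $p$ is the largest $k$ such that $f^*u=0\in H^q(Y;G)$ for all continuous $f:Y\to B$ with $\mathrm{genus}(f^*p)\le k$, where $f^*p$ is the pullback of $p$ along $f$ (and $\infty$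 if there is no largest $k$). Let $X$ be a topological space, let $n\ge 2$, let $X^I$ be the space of paths $I=[0,1]\to X$ with the compact-open topology, and let $$\pi:X^I\to X^n,\qquad \pi(\gamma)=\Bigl(\gamma(0),\gamma\bigl(\tfrac1{n-1}\bigr),\dots,\gamma\bigl(\tfrac{n-1}{n-1}\bigr)\Bigr).$$ Let $p_i:X^n\to X$ be the projection onto the $i$-th factor, and for $v\in H^m(X;R)$ put $\bar v_{ij}=p_j^*(v)-p_i^*(v)\in H^m(X^n;R)$. **Theorem.** Let $\mu:H^*(-;R)\to H^{*+k}(-;S)$ be a stable cohomology operation, and let $m\ge 0$ be an integer with $e(\mu)\ge m$. Then for every $v\in H^m(X;R)$ and all $1\le i,j\le n$, $$\mu(\bar v_{ij})=p_j^*\mu(v)-p_i^*\mu(v)\qquad\text{and}\qquad \mathrm{wgt}_\pi\bigl(\mu(\bar v_{ij})\bigr)\ge 2 .$$ -/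

import Mathlib

universe u v w

noncomputable section

namespace TCWeight

/-! ### Singular cohomology, graded by the integers -/

/-- Singular simplices of dimension `p` in `X`; there are none if `p < 0`. -/
def SingularSimplex (X : Type u) [TopologicalSpace X] : ℤ → Type u
  | Int.ofNat n => C(stdSimplex ℝ (Fin (n + 1)), X)
  | Int.negSucc _ => PEmpty

/-- The inclusion of the `i`-th face (opposite to the vertex `i`) of the standard simplex. -/
def faceInclusion {n : ℕ} (i : Fin (n + 2)) :
    C(stdSimplex ℝ (Fin (n + 1)), stdSimplex ℝ (Fin (n + 2))) :=
  ⟨stdSimplex.map i.succAbove, stdSimplex.continuous_map _⟩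

/-- Composition of a singular simplex with a continuous map. -/
def SingularSimplex.map {X Y : Type*} [TopologicalSpace X] [TopologicalSpace Y] (f : C(X, Y)) :
    (p : ℤ) → SingularSimplex X p → SingularSimplex Y p
  | Int.ofNat n => fun σ : C(stdSimplex ℝ (Fin (n + 1)), X) => f.comp σ
  | Int.negSucc _ => fun σ : PEmpty => σ.elim

/-- The group `C^p(X; R)` of singular cochains. -/
abbrev Cochain (R : Type v) [AddCommGroup R] (X : Type u) [TopologicalSpace X] (p : ℤ) :
    Type (max u v) :=
  SingularSimplex X p → R

/-- The coboundary `C^p(X; R) → C^{p+1}(X; R)`,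
`(df)(σ) = ∑ i, (-1)^i f(σ ∘ (i-th face inclusion))`. -/
def coboundary (R : Type v) [AddCommGroup R] (X : Type u) [TopologicalSpace X] :
    (p : ℤ) → Cochain R X p →+ Cochain R X (p + 1)
  | Int.ofNat n =>
    { toFun := fun (f : C(stdSimplex ℝ (Fin (n + 1)), X) → R)
          (σ : C(stdSimplex ℝ (Fin (n + 2)), X)) =>
        ∑ i : Fin (n + 2), ((-1 : ℤ) ^ (i : ℕ)) • f (σ.comp (faceInclusion i))
      map_zero' := by
        funext σ
        exact Finset.sum_eq_zero fun i _ => smul_zero _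
      map_add' := fun f g => by
        funext σ
        exact (Finset.sum_congr rfl fun i _ => smul_add _ _ _).trans Finset.sum_add_distrib }
  | Int.negSucc _ => 0

/-- The coboundary `C^p(X; R) → C^q(X; R)` for `q = p + 1`. -/
def d (R : Type v) [AddCommGroup R] (X : Type u) [TopologicalSpace X] :
    (p q : ℤ) → p + 1 = q → (Cochain R X p →+ Cochain R X q)
  | p, _, rfl => coboundary R X p

def cocycles (R : Type v) [AddCommGroup R] (X : Type u) [TopologicalSpace X] (p : ℤ) :
    AddSubgroup (Cochain R X p) :=
  (d R X p (p + 1) rfl).ker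

def coboundaries (R : Type v) [AddCommGroup R] (X : Type u) [TopologicalSpace X] (p : ℤ) :
    AddSubgroup (Cochain R X p) :=
  (d R X (p - 1) p (sub_add_cancel p 1)).range

/-- Singular cohomology `H^p(X; R)`, `p ∈ ℤ`. -/
abbrev Cohomology (R : Type v) [AddCommGroup R] (X : Type u) [TopologicalSpace X] (p : ℤ) :
    Type (max u v) :=
  cocycles R X p ⧸ (coboundaries R X p).addSubgroupOf (cocycles R X p)

/-- The cohomology class of a cocycle. -/
def cls {R : Type v} [AddCommGroup R] {X : Type u} [TopologicalSpace X] {p : ℤ}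
    (c : cocycles R X p) : Cohomology R X p :=
  QuotientAddGroup.mk c

/-- The cochain map induced by a continuous map. -/
def Cochain.pull {R : Type v} [AddCommGroup R] {X : Type u} {Y : Type w} [TopologicalSpace X]
    [TopologicalSpace Y] (f : C(X, Y)) (p : ℤ) : Cochain R Y p →+ Cochain R X p where
  toFun c σ := c (SingularSimplex.map f p σ)
  map_zero' := rfl
  map_add' _ _ := rfl

theorem d_pull {R : Type v} [AddCommGroup R] {X : Type u} {Y : Type w} [TopologicalSpace X]
    [TopologicalSpace Y] (f : C(X, Y)) (p q : ℤ) (h : p + 1 = q) (c : Cochain R Y p) :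
    d R X p q h (Cochain.pull f p c) = Cochain.pull f q (d R Y p q h c) := by
  subst h
  cases p with
  | ofNat n => rfl
  | negSucc n => rfl

/-- The homomorphism `f^* : H^p(Y; R) → H^p(X; R)` induced by `f : X → Y`. -/
def pullback {R : Type v} [AddCommGroup R] {X : Type u} {Y : Type w} [TopologicalSpace X]
    [TopologicalSpace Y] (f : C(X, Y)) (p : ℤ) : Cohomology R Y p →+ Cohomology R X p :=
  QuotientAddGroup.map _ _
    (((Cochain.pull f p).comp (cocycles R Y p).subtype).codRestrict (cocycles R X p) fun c => by
      have hc : d R Y p (p + 1) rfl c.1 = 0 := c.2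
      change d R X p (p + 1) rfl (Cochain.pull f p c.1) = 0
      rw [d_pull, hc, map_zero])
    (by
      rintro c ⟨b, hb⟩
      exact ⟨Cochain.pull f _ b, by rw [d_pull, hb]; rfl⟩)

/-! ### Suspension -/

/-- The graph of the Mayer–Vietoris connecting homomorphism
`H^p(U ∩ V; R) → H^q(Y; R)`, `q = p + 1`: the class of a cocycle `κ = α|_{U ∩ V} - β|_{U ∩ V}`
corresponds to the class of a cocycle `γ` with `γ|_U = dα` and `γ|_V = dβ`. -/
def IsMVConnecting {R : Type v} [AddCommGroup R] {Y : Type u} [TopologicalSpace Y] (U V : Set Y)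
    {p q : ℤ} (h : p + 1 = q) (a : Cohomology R ↥(U ∩ V) p) (b : Cohomology R Y q) : Prop :=
  ∃ (α : Cochain R U p) (β : Cochain R V p) (κ : cocycles R ↥(U ∩ V) p) (γ : cocycles R Y q),
    d R U p q h α = Cochain.pull ⟨Subtype.val, continuous_subtype_val⟩ q (γ : Cochain R Y q) ∧
    d R V p q h β = Cochain.pull ⟨Subtype.val, continuous_subtype_val⟩ q (γ : Cochain R Y q) ∧
    (κ : Cochain R ↥(U ∩ V) p) =
      Cochain.pull (ContinuousMap.inclusion Set.inter_subset_left) p α -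
        Cochain.pull (ContinuousMap.inclusion Set.inter_subset_right) p β ∧
    cls κ = a ∧ cls γ = b

/-- The relation on `X × [0, 1]` that identifies each of the two ends to a point. -/
def suspensionRel (X : Type u) (a b : X × unitInterval) : Prop :=
  (a.2 = 0 ∧ b.2 = 0) ∨ (a.2 = 1 ∧ b.2 = 1)

/-- The (unreduced) suspension of `X`, with the quotient topology. -/
def Suspension (X : Type u) : Type u := Quot (suspensionRel X)

instance (X : Type u) [TopologicalSpace X] : TopologicalSpace (Suspension X) :=
  inferInstanceAs (TopologicalSpace (Quot (suspensionRel X)))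

/-- The second coordinate on the suspension. -/
def Suspension.height {X : Type u} : Suspension X → unitInterval :=
  Quot.lift Prod.snd (by
    rintro a b (⟨ha, hb⟩ | ⟨ha, hb⟩)
    · rw [ha, hb]
    · rw [ha, hb])

/-- The suspension with one of its two cone points removed: an open cone. -/
def Suspension.upper (X : Type u) : Set (Suspension X) := {z | 0 < z.height}

/-- The suspension with the other cone point removed: an open cone. -/
def Suspension.lower (X : Type u) : Set (Suspension X) := {z | z.height < 1}

/-- The inclusion of `X` at height `1/2` into the intersection of the two open cones. -/
def Suspension.equator (X : Type u) [TopologicalSpace X] :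
    C(X, ↥(Suspension.upper X ∩ Suspension.lower X)) where
  toFun x := ⟨Quot.mk _ (x, ⟨1 / 2, by norm_num, by norm_num⟩),
    show (0 : ℝ) < 1 / 2 by norm_num, show (1 / 2 : ℝ) < 1 by norm_num⟩
  continuous_toFun := by
    refine Continuous.subtype_mk ?_ _
    exact continuous_quot_mk.comp (by fun_prop)

/-- Reduced cohomology of the pointed space `(X, x₀)`: the kernel of the restriction
to the base point. -/
def reduced (R : Type v) [AddCommGroup R] {X : Type u} [TopologicalSpace X] (x₀ : X) (p : ℤ) :
    AddSubgroup (Cohomology R X p) :=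
  (pullback (R := R) (ContinuousMap.const PUnit.{u + 1} x₀) p).ker

/-- The graph of the suspension homomorphism `H^p(X; R) → H^q(ΣX; R)`, `q = p + 1`: the
Mayer–Vietoris connecting homomorphism of the two open cones, whose intersection is identified
with `X` by the inclusion of the equator. On reduced cohomology it is the suspension isomorphism. -/
def IsSuspension {R : Type v} [AddCommGroup R] {X : Type u} [TopologicalSpace X]
    {p q : ℤ} (h : p + 1 = q) (a : Cohomology R X p) (b : Cohomology R (Suspension X) q) : Prop :=
  ∃ a' : Cohomology R ↥(Suspension.upper X ∩ Suspension.lower X) p,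
    pullback (Suspension.equator X) p a' = a ∧
      IsMVConnecting (Suspension.upper X) (Suspension.lower X) h a' b

/-! ### Stable cohomology operations -/

/-- A stable cohomology operation `H^*(-; R) → H^{*+k}(-; S)`: a family, indexed by `p ∈ ℤ`, of
natural transformations (of set-valued functors) `H^p(-; R) → H^{p+k}(-; S)` that commutes with
the suspension isomorphisms of reduced cohomology. -/
structure StableOperation (R : Type v) [AddCommGroup R] (S : Type w) [AddCommGroup S] (k : ℤ) where
  op : ∀ (X : Type u) [TopologicalSpace X] (p : ℤ), Cohomology R X p → Cohomology S X (p + k)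
  natural : ∀ (X Y : Type u) [TopologicalSpace X] [TopologicalSpace Y] (f : C(X, Y)) (p : ℤ)
    (a : Cohomology R Y p), op X p (pullback f p a) = pullback f (p + k) (op Y p a)
  suspension : ∀ (X : Type u) [TopologicalSpace X] (x₀ : X) (p q : ℤ) (h : p + 1 = q)
    (a : Cohomology R X p) (b : Cohomology R (Suspension X) q), a ∈ reduced R x₀ p →
    IsSuspension h a b →
    IsSuspension (show p + k + 1 = q + k by omega) (op X p a) (op (Suspension X) q b)

/-- The excess `max {l | μ(u) = 0 for all X and all u ∈ H^l(X; R)} + 1`; it is `∞` if there are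
arbitrarily large such `l`, and `0` if no `l ≥ 0` is such. -/
def StableOperation.excess {R : Type v} [AddCommGroup R] {S : Type w} [AddCommGroup S] {k : ℤ}
    (μ : StableOperation.{u} R S k) : ℕ∞ :=
  sSup ((fun l : ℕ => (l : ℕ∞) + 1) ''
    {l : ℕ | ∀ (X : Type u) [TopologicalSpace X] (u : Cohomology R X l), μ.op X l u = 0})

/-! ### Genus, weight and the path fibration -/

/-- The genus of `p : E → B`: the least `k` such that `B` is covered by `k` open sets on each of
which `p` has a continuous section (`∞` if there is no such `k`). -/
def genus {E : Type v} {B : Type w} [TopologicalSpace E] [TopologicalSpace B] (p : C(E, B)) : ℕ∞ :=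
  sInf ((fun k : ℕ => (k : ℕ∞)) ''
    {k : ℕ | ∃ U : Fin k → Set B, (∀ i, IsOpen (U i)) ∧ (⋃ i, U i) = Set.univ ∧
      ∀ i, ∃ s : C(U i, E), ∀ b : U i, p (s b) = b})

/-- The pullback `f^*p : Y ×_B E → Y` of `p : E → B` along `f : Y → B`. -/
def pullbackMap {E Y B : Type*} [TopologicalSpace E] [TopologicalSpace Y] [TopologicalSpace B]
    (p : C(E, B)) (f : C(Y, B)) : C({z : Y × E // f z.1 = p z.2}, Y) :=
  ⟨fun z => z.1.1, by fun_prop⟩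

/-- The weight of `u ∈ H^q(B; G)` with respect to `p : E → B`: the largest `k` such that
`f^*u = 0` for all `f : Y → B` with `genus (f^*p) ≤ k` (`∞` if there is no largest one). -/
def wgt {G : Type w} [AddCommGroup G] {E B : Type u} [TopologicalSpace E] [TopologicalSpace B]
    (p : C(E, B)) {q : ℤ} (u : Cohomology G B q) : ℕ∞ :=
  sSup ((fun k : ℕ => (k : ℕ∞)) ''
    {k : ℕ | ∀ (Y : Type u) [TopologicalSpace Y] (f : C(Y, B)),
      genus (pullbackMap p f) ≤ k → pullback f q u = 0})

/-- The path fibration `π : X^I → X^n`, `γ ↦ (γ(0), γ(1/(n-1)), …, γ((n-1)/(n-1)))`, with the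
compact-open topology on `X^I` (meant for `n ≥ 2`). -/
def pathFibration (X : Type u) [TopologicalSpace X] (n : ℕ) :
    C(C(unitInterval, X), Fin n → X) where
  toFun γ i := γ ⟨(i : ℝ) / ((n : ℝ) - 1), by
    have hi : (i : ℝ) + 1 ≤ n := by exact_mod_cast i.2
    have h0 : (0 : ℝ) ≤ (i : ℕ) := Nat.cast_nonneg _
    exact ⟨div_nonneg h0 (by linarith), div_le_one_of_le₀ (by linarith) (by linarith)⟩⟩
  continuous_toFun := continuous_pi fun _ => continuous_eval_const _

/-- The projection of `X^n` onto the `i`-th factor. -/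
def proj (X : Type u) [TopologicalSpace X] {n : ℕ} (i : Fin n) : C(Fin n → X, X) :=
  ⟨fun x => x i, continuous_apply i⟩

/-- The zero-divisor `v̄_{ij} = p_j^* v - p_i^* v`. -/
def zeroDivisor {R : Type v} [AddCommGroup R] {X : Type u} [TopologicalSpace X] {n : ℕ}
    (i j : Fin n) {m : ℤ} (v : Cohomology R X m) : Cohomology R (Fin n → X) m :=
  pullback (proj X j) m v - pullback (proj X i) m v

end TCWeight

end

noncomputable section

namespace TCWeight

/-! ### Chains of vertex tuples

The augmented complex of tuples of points of `K`: the group `VChain K n` is free on the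
`n`-tuples, so that tuples of length `n + 1` play the role of affine `n`-simplices. -/

abbrev VChain (K : Type*) (n : ℕ) := FreeAbelianGroup (Fin n → K)

/-- The generator of `VChain K n` given by a tuple. -/
abbrev tup {K : Type*} {n : ℕ} (v : Fin n → K) : VChain K n := FreeAbelianGroup.of v

def bdry {K : Type*} {n : ℕ} : VChain K (n + 1) →+ VChain K n :=
  FreeAbelianGroup.lift fun v => ∑ i : Fin (n + 1), ((-1 : ℤ) ^ (i : ℕ)) • tup (v ∘ i.succAbove)

def cone {K : Type*} {n : ℕ} (b : K) : VChain K n →+ VChain K (n + 1) :=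
  FreeAbelianGroup.lift fun v => tup (Fin.cons b v : Fin (n + 1) → K)

def vmap {K L : Type*} (φ : K → L) {n : ℕ} : VChain K n →+ VChain L n :=
  FreeAbelianGroup.lift fun v => tup (φ ∘ v)

theorem bdry_tup {K : Type*} {n : ℕ} (v : Fin (n + 1) → K) :
    bdry (tup v) = ∑ i : Fin (n + 1), ((-1 : ℤ) ^ (i : ℕ)) • tup (v ∘ i.succAbove) :=
  FreeAbelianGroup.lift_apply_of _ _

theorem cone_tup {K : Type*} {n : ℕ} (b : K) (v : Fin n → K) :
    cone b (tup v) = tup (Fin.cons b v : Fin (n + 1) → K) :=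
  FreeAbelianGroup.lift_apply_of _ _

theorem vmap_tup {K L : Type*} (φ : K → L) {n : ℕ} (v : Fin n → K) :
    vmap φ (tup v) = tup (φ ∘ v) :=
  FreeAbelianGroup.lift_apply_of _ _

/-- Homomorphisms on chains are determined by their values on tuples. -/
theorem VChain.hom_congr {K : Type*} {n : ℕ} {G : Type*} [AddCommGroup G] {f g : VChain K n →+ G}
    (h : ∀ v, f (tup v) = g (tup v)) (c : VChain K n) : f c = g c :=
  DFunLike.congr_fun (FreeAbelianGroup.lift_ext f g h) c

/-- Face `0` of a cone is its base, and face `i + 1` is the cone over face `i` with the opposite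
sign. The complex is augmented by the empty tuple, so single points need no extra term here. -/
theorem bdry_cone {K : Type*} {n : ℕ} (b : K) (c : VChain K (n + 1)) :
    bdry (cone b c) = c - cone b (bdry c) := by
  refine VChain.hom_congr (f := bdry.comp (cone b))
    (g := AddMonoidHom.id _ - (cone b).comp bdry) (fun v => ?_) c
  simp only [AddMonoidHom.comp_apply, AddMonoidHom.sub_apply, AddMonoidHom.id_apply, cone_tup,
    bdry_tup, map_sum, map_zsmul]
  rw [Fin.sum_univ_succ, sub_eq_add_neg, ← Finset.sum_neg_distrib]
  refine congrArg₂ (· + ·) ?_ (Finset.sum_congr rfl fun i _ => ?_)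
  · simp only [Fin.val_zero, pow_zero, one_smul]
    exact congrArg tup (funext fun j => by simp)
  · rw [Fin.val_succ, pow_succ, mul_neg_one, neg_smul]
    congr 3
    funext j
    refine Fin.cases ?_ (fun j => ?_) j
    · simp
    · simp

theorem bdry_cone_zero {K : Type*} (b : K) (c : VChain K 0) : bdry (cone b c) = c := by
  refine VChain.hom_congr (f := bdry.comp (cone b)) (g := AddMonoidHom.id _) (fun v => ?_) c
  simp only [AddMonoidHom.comp_apply, AddMonoidHom.id_apply, cone_tup, bdry_tup]
  rw [Fin.sum_univ_succ, Finset.univ_eq_empty, Finset.sum_empty, add_zero, Fin.val_zero, pow_zero,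
    one_smul]
  exact congrArg tup (Subsingleton.elim _ _)

theorem tup_eq_cone {K : Type*} {n : ℕ} (v : Fin (n + 1) → K) :
    tup v = cone (v 0) (tup (Fin.tail v)) := by
  rw [cone_tup, Fin.cons_self_tail]

/-- Every nonempty tuple is the cone from its first vertex over its tail, so the cone formula and
induction replace the usual cancellation of double faces. -/
theorem bdry_bdry {K : Type*} : ∀ {n : ℕ} (c : VChain K (n + 2)), bdry (bdry c) = 0
  | 0, c => by
    refine VChain.hom_congr (f := bdry.comp bdry) (g := 0) (fun v => ?_) c
    simp only [AddMonoidHom.comp_apply, AddMonoidHom.zero_apply]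
    rw [tup_eq_cone, bdry_cone, map_sub, bdry_cone_zero, sub_self]
  | n + 1, c => by
    refine VChain.hom_congr (f := bdry.comp bdry) (g := 0) (fun v => ?_) c
    simp only [AddMonoidHom.comp_apply, AddMonoidHom.zero_apply]
    rw [tup_eq_cone, bdry_cone, map_sub, bdry_cone, bdry_bdry, map_zero, sub_zero, sub_self]

theorem vmap_bdry {K L : Type*} (φ : K → L) {n : ℕ} (c : VChain K (n + 1)) :
    vmap φ (bdry c) = bdry (vmap φ c) := by
  refine VChain.hom_congr (f := (vmap φ).comp bdry) (g := bdry.comp (vmap φ)) (fun v => ?_) c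
  simp only [AddMonoidHom.comp_apply, vmap_tup, bdry_tup, map_sum, map_zsmul]
  rfl

theorem vmap_cone {K L : Type*} (φ : K → L) {n : ℕ} (b : K) (c : VChain K n) :
    vmap φ (cone b c) = cone (φ b) (vmap φ c) := by
  refine VChain.hom_congr (f := (vmap φ).comp (cone b)) (g := (cone (φ b)).comp (vmap φ))
    (fun v => ?_) c
  simp only [AddMonoidHom.comp_apply, vmap_tup, cone_tup]
  refine congrArg tup (funext fun j => ?_)
  refine Fin.cases ?_ (fun j => ?_) j <;> simp

/-- The homotopy between two chain maps obtained by coning off. -/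
def coneHomotopy {K L : Type*} (f g : ∀ n, VChain K n →+ VChain L n)
    (b : ∀ n, (Fin (n + 1) → K) → L) : ∀ n, VChain K n →+ VChain L (n + 1)
  | 0 => 0
  | n + 1 => FreeAbelianGroup.lift fun v =>
      cone (b n v) (f _ (tup v) - g _ (tup v) - coneHomotopy f g b n (bdry (tup v)))

section coneHomotopy

variable {K L : Type*} {f g : ∀ n, VChain K n →+ VChain L n} {b : ∀ n, (Fin (n + 1) → K) → L}

theorem coneHomotopy_tup (n : ℕ) (v : Fin (n + 1) → K) :
    coneHomotopy f g b (n + 1) (tup v) =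
      cone (b n v) (f _ (tup v) - g _ (tup v) - coneHomotopy f g b n (bdry (tup v))) :=
  FreeAbelianGroup.lift_apply_of _ _

/-- By induction `f v - g v - h(∂v)` is a cycle, and the cone over a cycle bounds it. The induction
starts because both maps agree on the empty tuple. -/
theorem bdry_coneHomotopy (hf : ∀ n c, bdry (f (n + 1) c) = f n (bdry c))
    (hg : ∀ n c, bdry (g (n + 1) c) = g n (bdry c)) (h0 : ∀ c, f 0 c = g 0 c) :
    ∀ (n : ℕ) (c : VChain K (n + 1)),
      bdry (coneHomotopy f g b (n + 1) c) = f _ c - g _ c - coneHomotopy f g b n (bdry c)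
  | n, c => by
    refine VChain.hom_congr (f := bdry.comp (coneHomotopy f g b (n + 1)))
      (g := f _ - g _ - (coneHomotopy f g b n).comp bdry) (fun v => ?_) c
    simp only [AddMonoidHom.comp_apply, AddMonoidHom.sub_apply]
    rw [coneHomotopy_tup, bdry_cone, sub_eq_self]
    rw [map_sub bdry, map_sub bdry, hf, hg]
    cases n with
    | zero => rw [h0, sub_self]; simp [coneHomotopy]
    | succ n =>
      rw [bdry_coneHomotopy hf hg h0 n, bdry_bdry, map_zero, sub_zero, sub_self, map_zero]

/-- Naturality of the cone points suffices for naturality of the homotopy. For face inclusions this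
turns operators on tuples into operators on singular cochains. -/
theorem vmap_coneHomotopy {K' L' : Type*} {f' g' : ∀ n, VChain K' n →+ VChain L' n}
    {b' : ∀ n, (Fin (n + 1) → K') → L'} (φ : K → K') (ψ : L → L')
    (hf : ∀ n c, vmap ψ (f n c) = f' n (vmap φ c)) (hg : ∀ n c, vmap ψ (g n c) = g' n (vmap φ c))
    (hb : ∀ n v, ψ (b n v) = b' n (φ ∘ v)) : ∀ (n : ℕ) (c : VChain K n),
      vmap ψ (coneHomotopy f g b n c) = coneHomotopy f' g' b' n (vmap φ c)
  | 0, c => by simp [coneHomotopy]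
  | n + 1, c => by
    refine VChain.hom_congr (f := (vmap ψ).comp (coneHomotopy f g b (n + 1)))
      (g := (coneHomotopy f' g' b' (n + 1)).comp (vmap φ)) (fun v => ?_) c
    simp only [AddMonoidHom.comp_apply]
    rw [coneHomotopy_tup, vmap_cone, vmap_tup, coneHomotopy_tup, map_sub (vmap ψ),
      map_sub (vmap ψ), hf, hg, hb,
      vmap_coneHomotopy φ ψ hf hg hb n, vmap_bdry, vmap_tup]

end coneHomotopy

/-! ### Subdivision and its homotopy to the identity. -/

/-- The subdivision operator obtained by coning off, from `b v`, the subdivision of the boundary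
of `v`. -/
def subdiv {K : Type*} (b : ∀ n, (Fin (n + 1) → K) → K) : ∀ n, VChain K n →+ VChain K n
  | 0 => AddMonoidHom.id _
  | n + 1 => FreeAbelianGroup.lift fun v => cone (b n v) (subdiv b n (bdry (tup v)))

section subdiv

variable {K : Type*} {b : ∀ n, (Fin (n + 1) → K) → K}

theorem subdiv_tup (n : ℕ) (v : Fin (n + 1) → K) :
    subdiv b (n + 1) (tup v) = cone (b n v) (subdiv b n (bdry (tup v))) :=
  FreeAbelianGroup.lift_apply_of _ _

theorem bdry_subdiv : ∀ (n : ℕ) (c : VChain K (n + 1)),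
    bdry (subdiv b (n + 1) c) = subdiv b n (bdry c)
  | n, c => by
    refine VChain.hom_congr (f := bdry.comp (subdiv b (n + 1)))
      (g := (subdiv b n).comp bdry) (fun v => ?_) c
    simp only [AddMonoidHom.comp_apply]
    cases n with
    | zero => rw [subdiv_tup, bdry_cone_zero]
    | succ n =>
      rw [subdiv_tup, bdry_cone, sub_eq_self, bdry_subdiv n, bdry_bdry, map_zero, map_zero]

theorem vmap_subdiv {K' : Type*} {b' : ∀ n, (Fin (n + 1) → K') → K'} (φ : K → K')
    (hb : ∀ n v, φ (b n v) = b' n (φ ∘ v)) : ∀ (n : ℕ) (c : VChain K n),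
      vmap φ (subdiv b n c) = subdiv b' n (vmap φ c)
  | 0, c => rfl
  | n + 1, c => by
    refine VChain.hom_congr (f := (vmap φ).comp (subdiv b (n + 1)))
      (g := (subdiv b' (n + 1)).comp (vmap φ)) (fun v => ?_) c
    simp only [AddMonoidHom.comp_apply]
    rw [subdiv_tup, vmap_cone, vmap_tup, subdiv_tup, hb, vmap_subdiv φ hb n, vmap_bdry, vmap_tup]

variable (b) in
/-- The homotopy between the identity and the subdivision operator. -/
def subdivHomotopy (n : ℕ) : VChain K n →+ VChain K (n + 1) :=
  coneHomotopy (fun _ => AddMonoidHom.id _) (subdiv b) (fun _ v => v 0) n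

theorem bdry_subdivHomotopy (n : ℕ) (c : VChain K (n + 1)) :
    bdry (subdivHomotopy b (n + 1) c) =
      c - subdiv b (n + 1) c - subdivHomotopy b n (bdry c) :=
  bdry_coneHomotopy (f := fun _ => AddMonoidHom.id _) (g := subdiv b) (fun _ _ => rfl)
    (fun n c => bdry_subdiv n c) (fun _ => rfl) n c

variable (b) in
/-- The `m`-fold subdivision operator. -/
def iterSubdiv (n : ℕ) : ℕ → (VChain K n →+ VChain K n)
  | 0 => AddMonoidHom.id _
  | m + 1 => (subdiv b n).comp (iterSubdiv n m)

variable (b) in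
/-- The homotopy between the identity and the `m`-fold subdivision operator. -/
def iterHomotopy (n : ℕ) : ℕ → (VChain K n →+ VChain K (n + 1))
  | 0 => 0
  | m + 1 => iterHomotopy n m + (subdivHomotopy b n).comp (iterSubdiv b n m)

theorem iterSubdiv_succ (n m : ℕ) (c : VChain K n) :
    iterSubdiv b n (m + 1) c = subdiv b n (iterSubdiv b n m c) := rfl

theorem iterHomotopy_succ (n m : ℕ) (c : VChain K n) :
    iterHomotopy b n (m + 1) c =
      iterHomotopy b n m c + subdivHomotopy b n (iterSubdiv b n m c) := rfl

theorem bdry_iterSubdiv (n m : ℕ) (c : VChain K (n + 1)) :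
    bdry (iterSubdiv b (n + 1) m c) = iterSubdiv b n m (bdry c) := by
  induction m with
  | zero => rfl
  | succ m ih => rw [iterSubdiv_succ, iterSubdiv_succ, bdry_subdiv, ih]

theorem bdry_iterHomotopy (n m : ℕ) (c : VChain K (n + 1)) :
    bdry (iterHomotopy b (n + 1) m c) =
      c - iterSubdiv b (n + 1) m c - iterHomotopy b n m (bdry c) := by
  induction m with
  | zero => simp [iterHomotopy, iterSubdiv]
  | succ m ih =>
    rw [iterHomotopy_succ, map_add, ih, bdry_subdivHomotopy, iterHomotopy_succ, bdry_iterSubdiv,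
      iterSubdiv_succ]
    abel

theorem vmap_iterSubdiv {K' : Type*} {b' : ∀ n, (Fin (n + 1) → K') → K'} (φ : K → K')
    (hb : ∀ n v, φ (b n v) = b' n (φ ∘ v)) (n m : ℕ) (c : VChain K n) :
    vmap φ (iterSubdiv b n m c) = iterSubdiv b' n m (vmap φ c) := by
  induction m with
  | zero => rfl
  | succ m ih => rw [iterSubdiv_succ, iterSubdiv_succ, vmap_subdiv φ hb, ih]

theorem vmap_iterHomotopy {K' : Type*} {b' : ∀ n, (Fin (n + 1) → K') → K'} (φ : K → K')
    (hb : ∀ n v, φ (b n v) = b' n (φ ∘ v)) (n m : ℕ) (c : VChain K n) :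
    vmap φ (iterHomotopy b n m c) = iterHomotopy b' n m (vmap φ c) := by
  induction m with
  | zero => simp [iterHomotopy]
  | succ m ih =>
    rw [iterHomotopy_succ, map_add, ih, iterHomotopy_succ, ← vmap_iterSubdiv φ hb]
    congr 1
    exact vmap_coneHomotopy (f := fun _ => AddMonoidHom.id _) (g := subdiv b)
      (f' := fun _ => AddMonoidHom.id _) (g' := subdiv b') φ φ (fun _ _ => rfl)
      (fun n c => vmap_subdiv φ hb n c) (fun _ _ => rfl) n _

end subdiv

/-! ### Affine simplices in convex sets -/

section join

variable {E : Type*} [NormedAddCommGroup E] [NormedSpace ℝ E] {s : Set E}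

/-- The affine simplex in a convex set with the given vertices. -/
def join (hs : Convex ℝ s) {k : ℕ} (w : Fin k → s) : C(stdSimplex ℝ (Fin k), s) where
  toFun x := ⟨∑ i, x i • (w i : E), hs.sum_mem (fun i _ => x.2.1 i) x.2.2 fun i _ => (w i).2⟩
  continuous_toFun := by
    refine Continuous.subtype_mk (continuous_finsetSum _ fun i _ => ?_) _
    exact ((continuous_apply i).comp continuous_subtype_val).smul continuous_const

theorem coe_join (hs : Convex ℝ s) {k : ℕ} (w : Fin k → s) (x : stdSimplex ℝ (Fin k)) :
    (join hs w x : E) = ∑ i, x i • (w i : E) := rfl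

theorem join_mem (hs : Convex ℝ s) {k : ℕ} (w : Fin k → s) {A : Set E} (hA : Convex ℝ A)
    (hw : ∀ i, (w i : E) ∈ A) (x : stdSimplex ℝ (Fin k)) : (join hs w x : E) ∈ A :=
  hA.sum_mem (fun i _ => x.2.1 i) x.2.2 fun i _ => hw i

theorem sum_map_smul {k l : ℕ} (f : Fin k → Fin l) (x : stdSimplex ℝ (Fin k)) (w : Fin l → E) :
    ∑ j, stdSimplex.map f x j • w j = ∑ i, x i • w (f i) := by
  rw [← Finset.sum_fiberwise (s := Finset.univ) (g := f)]
  refine Finset.sum_congr rfl fun j _ => ?_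
  rw [stdSimplex.map_coe, FunOnFinite.linearMap_apply_apply, Finset.sum_smul]
  refine Finset.sum_congr rfl fun i hi => ?_
  rw [(Finset.mem_filter.1 hi).2]

theorem join_comp_faceInclusion (hs : Convex ℝ s) {k : ℕ} (w : Fin (k + 2) → s)
    (i : Fin (k + 2)) : (join hs w).comp (faceInclusion i) = join hs (w ∘ i.succAbove) := by
  ext x
  exact sum_map_smul i.succAbove x fun j => (w j : E)

/-- Maps between convex sets that commute with affine combinations. -/
def IsAffine {F : Type*} [NormedAddCommGroup F] [NormedSpace ℝ F] {t : Set F} (hs : Convex ℝ s)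
    (ht : Convex ℝ t) (φ : C(s, t)) : Prop :=
  ∀ (k : ℕ) (w : Fin k → s), φ.comp (join hs w) = join ht (φ ∘ w)

theorem isAffine_of_linear {F : Type*} [NormedAddCommGroup F] [NormedSpace ℝ F] {t : Set F}
    (hs : Convex ℝ s) (ht : Convex ℝ t) (φ : C(s, t)) (T : E →ₗ[ℝ] F)
    (h : ∀ x : s, (φ x : F) = T x) : IsAffine hs ht φ := by
  intro k w
  ext x
  simp only [ContinuousMap.comp_apply, h, coe_join, map_sum, map_smul, Function.comp_apply]

theorem isAffine_faceInclusion {n : ℕ} (i : Fin (n + 2)) :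
    IsAffine (convex_stdSimplex ℝ (Fin (n + 1))) (convex_stdSimplex ℝ (Fin (n + 2)))
      (faceInclusion i) :=
  isAffine_of_linear _ _ _ (FunOnFinite.linearMap ℝ ℝ i.succAbove) fun _ => rfl

/-- The barycenter of a tuple of points. -/
def bary (hs : Convex ℝ s) (n : ℕ) (v : Fin (n + 1) → s) : s :=
  join hs v stdSimplex.barycenter

theorem IsAffine.map_bary {F : Type*} [NormedAddCommGroup F] [NormedSpace ℝ F] {t : Set F}
    {hs : Convex ℝ s} {ht : Convex ℝ t} {φ : C(s, t)} (h : IsAffine hs ht φ) (n : ℕ)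
    (v : Fin (n + 1) → s) : φ (bary hs n v) = bary ht n (φ ∘ v) :=
  DFunLike.congr_fun (h _ v) _

/-- The tuple of the vertices of the standard simplex. -/
def verts (n : ℕ) : Fin (n + 1) → stdSimplex ℝ (Fin (n + 1)) := fun i => stdSimplex.vertex i

theorem join_verts (n : ℕ) :
    join (convex_stdSimplex ℝ (Fin (n + 1))) (verts n) = ContinuousMap.id _ := by
  ext x j
  change (∑ i, x i • ((verts n i : stdSimplex ℝ (Fin (n + 1))) : Fin (n + 1) → ℝ)) j = x j
  rw [Finset.sum_apply, Finset.sum_eq_single j]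
  · change x j • (Pi.single j (1 : ℝ) : Fin (n + 1) → ℝ) j = x j
    simp
  · intro i _ hi
    change x i • (Pi.single i (1 : ℝ) : Fin (n + 1) → ℝ) j = 0
    simp [Pi.single_eq_of_ne hi.symm]
  · simp

theorem faceInclusion_comp_verts {n : ℕ} (i : Fin (n + 2)) :
    faceInclusion i ∘ verts n = verts (n + 1) ∘ i.succAbove := by
  funext j
  exact stdSimplex.map_vertex _ _

end join

/-! ### Evaluation of cochains on affine chains -/

/-- The coboundary of a function on singular `n`-simplices. -/
def natCoboundary {R : Type*} [AddCommGroup R] {X : Type*} [TopologicalSpace X] {n : ℕ}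
    (f : C(stdSimplex ℝ (Fin (n + 1)), X) → R) (σ : C(stdSimplex ℝ (Fin (n + 2)), X)) : R :=
  ∑ i : Fin (n + 2), ((-1 : ℤ) ^ (i : ℕ)) • f (σ.comp (faceInclusion i))

section ev

variable {R : Type*} [AddCommGroup R] {X : Type*} [TopologicalSpace X]
  {E : Type*} [NormedAddCommGroup E] [NormedSpace ℝ E] {s : Set E}

/-- The value of a cochain on the push-forward of an affine chain. -/
def ev (hs : Convex ℝ s) {k : ℕ} (f : C(stdSimplex ℝ (Fin (k + 1)), X) → R) (σ : C(s, X)) :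
    VChain s (k + 1) →+ R :=
  FreeAbelianGroup.lift fun w => f (σ.comp (join hs w))

theorem ev_tup (hs : Convex ℝ s) {k : ℕ} (f : C(stdSimplex ℝ (Fin (k + 1)), X) → R)
    (σ : C(s, X)) (w : Fin (k + 1) → s) : ev hs f σ (tup w) = f (σ.comp (join hs w)) :=
  FreeAbelianGroup.lift_apply_of _ _

theorem ev_zero (hs : Convex ℝ s) {k : ℕ} (σ : C(s, X)) (c : VChain s (k + 1)) :
    ev hs (0 : C(stdSimplex ℝ (Fin (k + 1)), X) → R) σ c = 0 :=
  VChain.hom_congr (f := ev hs _ σ) (g := 0) (fun _ => ev_tup _ _ _ _) c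

theorem ev_bdry (hs : Convex ℝ s) {k : ℕ} (f : C(stdSimplex ℝ (Fin (k + 1)), X) → R)
    (σ : C(s, X)) (c : VChain s (k + 2)) :
    ev hs f σ (bdry c) = ev hs (natCoboundary f) σ c := by
  refine VChain.hom_congr (f := (ev hs f σ).comp bdry) (g := ev hs (natCoboundary f) σ)
    (fun v => ?_) c
  rw [AddMonoidHom.comp_apply, bdry_tup, map_sum, ev_tup]
  refine Finset.sum_congr rfl fun i _ => ?_
  rw [map_zsmul, ev_tup, ContinuousMap.comp_assoc, join_comp_faceInclusion]

theorem ev_comp {F : Type*} [NormedAddCommGroup F] [NormedSpace ℝ F] {t : Set F}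
    {hs : Convex ℝ s} {ht : Convex ℝ t} {φ : C(s, t)} (h : IsAffine hs ht φ) {k : ℕ}
    (f : C(stdSimplex ℝ (Fin (k + 1)), X) → R) (σ : C(t, X)) (c : VChain s (k + 1)) :
    ev hs f (σ.comp φ) c = ev ht f σ (vmap φ c) := by
  refine VChain.hom_congr (f := ev hs f (σ.comp φ)) (g := (ev ht f σ).comp (vmap φ))
    (fun v => ?_) c
  rw [AddMonoidHom.comp_apply, vmap_tup, ev_tup, ev_tup, ContinuousMap.comp_assoc, h]

theorem ev_verts {n : ℕ} (f : C(stdSimplex ℝ (Fin (n + 1)), X) → R)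
    (σ : C(stdSimplex ℝ (Fin (n + 1)), X)) :
    ev (convex_stdSimplex ℝ (Fin (n + 1))) f σ (tup (verts n)) = f σ := by
  rw [ev_tup, join_verts, ContinuousMap.comp_id]

/-- A cochain is recovered by evaluating on the tautological affine simplex, where the coboundary is
adjoint to `bdry`. -/
theorem natCoboundary_natCoboundary {n : ℕ} (f : C(stdSimplex ℝ (Fin (n + 1)), X) → R) :
    natCoboundary (natCoboundary f) = 0 := by
  funext σ
  rw [← ev_verts (natCoboundary (natCoboundary f)) σ, ← ev_bdry, ← ev_bdry, bdry_bdry, map_zero]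
  rfl

end ev

/-! ### Small chains -/

/-- The chains that are combinations of tuples with a given property. -/
def chainsOf {K : Type*} {n : ℕ} (P : (Fin n → K) → Prop) : AddSubgroup (VChain K n) :=
  AddSubgroup.closure (tup '' {w | P w})

section chainsOf

variable {K : Type*} {n : ℕ} {P : (Fin n → K) → Prop}

theorem tup_mem_chainsOf {w : Fin n → K} (h : P w) : tup w ∈ chainsOf P :=
  AddSubgroup.subset_closure ⟨w, h, rfl⟩

theorem map_mem_of_mem_chainsOf {G : Type*} [AddCommGroup G] {H : AddSubgroup G}
    (f : VChain K n →+ G) (h : ∀ w, P w → f (tup w) ∈ H) {c : VChain K n} (hc : c ∈ chainsOf P) :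
    f c ∈ H := by
  have : chainsOf P ≤ H.comap f := by
    refine (AddSubgroup.closure_le _).2 ?_
    rintro _ ⟨w, hw, rfl⟩
    exact h w hw
  exact this hc

theorem chainsOf_mono {Q : (Fin n → K) → Prop} (h : ∀ w, P w → Q w) {c : VChain K n}
    (hc : c ∈ chainsOf P) : c ∈ chainsOf Q :=
  map_mem_of_mem_chainsOf (AddMonoidHom.id _) (fun w hw => tup_mem_chainsOf (h w hw)) hc

theorem bdry_tup_mem_chainsOf {v : Fin (n + 1) → K} (h : ∀ i : Fin (n + 1), P (v ∘ i.succAbove)) :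
    bdry (tup v) ∈ chainsOf P := by
  rw [bdry_tup]
  exact AddSubgroup.sum_mem _ fun i _ => AddSubgroup.zsmul_mem _ (tup_mem_chainsOf (h i)) _

theorem cone_mem_chainsOf {Q : (Fin (n + 1) → K) → Prop} {b : K}
    (h : ∀ w, P w → Q (Fin.cons b w : Fin (n + 1) → K)) {c : VChain K n} (hc : c ∈ chainsOf P) :
    cone b c ∈ chainsOf Q :=
  map_mem_of_mem_chainsOf (cone b) (fun w hw => by
    rw [cone_tup]; exact tup_mem_chainsOf (h w hw)) hc

/-- Chains all of whose vertices lie in `A`. -/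
abbrev chainsIn {K : Type*} (A : Set K) (n : ℕ) : AddSubgroup (VChain K n) :=
  chainsOf fun w => ∀ i, w i ∈ A

theorem cone_mem_chainsIn {A : Set K} {b : K} (hb : b ∈ A) {c : VChain K n}
    (hc : c ∈ chainsIn A n) : cone b c ∈ chainsIn A (n + 1) :=
  cone_mem_chainsOf (fun w hw i => by
    refine Fin.cases ?_ (fun j => ?_) i
    · simpa using hb
    · simpa using hw j) hc

theorem subdiv_mem_chainsIn {b : ∀ n, (Fin (n + 1) → K) → K} {A : Set K}
    (hb : ∀ n v, (∀ i, v i ∈ A) → b n v ∈ A) : ∀ (n : ℕ) {c : VChain K n},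
      c ∈ chainsIn A n → subdiv b n c ∈ chainsIn A n
  | 0, _, hc => hc
  | n + 1, _, hc => by
    refine map_mem_of_mem_chainsOf (subdiv b (n + 1)) (fun v hv => ?_) hc
    rw [subdiv_tup]
    refine cone_mem_chainsIn (hb n v hv) (subdiv_mem_chainsIn hb n ?_)
    exact bdry_tup_mem_chainsOf fun i j => hv _

theorem subdivHomotopy_mem_chainsIn {b : ∀ n, (Fin (n + 1) → K) → K} {A : Set K}
    (hb : ∀ n v, (∀ i, v i ∈ A) → b n v ∈ A) : ∀ (n : ℕ) {c : VChain K n},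
      c ∈ chainsIn A n → subdivHomotopy b n c ∈ chainsIn A (n + 1)
  | 0, _, _ => AddSubgroup.zero_mem _
  | n + 1, _, hc => by
    refine map_mem_of_mem_chainsOf (subdivHomotopy b (n + 1)) (fun v hv => ?_) hc
    have hv' : tup v ∈ chainsIn A (n + 1) := tup_mem_chainsOf hv
    rw [subdivHomotopy, coneHomotopy_tup]
    refine cone_mem_chainsIn (hv 0) (AddSubgroup.sub_mem _ (AddSubgroup.sub_mem _ hv' ?_) ?_)
    · exact subdiv_mem_chainsIn hb _ hv'
    · exact subdivHomotopy_mem_chainsIn hb n (bdry_tup_mem_chainsOf fun i j => hv _)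

end chainsOf

/-! ### Barycentric subdivision shrinks diameters. -/

section mesh

variable {E : Type*} [NormedAddCommGroup E] [NormedSpace ℝ E] {s : Set E}

/-- The difference of `v j` and the barycenter is the mean of the `n + 1` vectors `v j - v i`, one
of which is zero. The weaker factor `N / (N + 1)` serves all faces of an `N`-simplex at once. -/
theorem dist_bary_le (hs : Convex ℝ s) {n N : ℕ} (hn : n ≤ N) (v : Fin (n + 1) → s) {δ : ℝ}
    (hv : ∀ i j, dist (v i) (v j) ≤ δ) (j : Fin (n + 1)) :
    dist (v j : E) (bary hs n v) ≤ (N / (N + 1) : ℝ) * δ := by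
  have hδ : 0 ≤ δ := dist_nonneg.trans (hv j j)
  have h1 : (v j : E) - bary hs n v = ∑ i, ((n : ℝ) + 1)⁻¹ • ((v j : E) - v i) := by
    have hb : (bary hs n v : E) = ∑ i, ((n : ℝ) + 1)⁻¹ • (v i : E) := by
      rw [bary, coe_join]
      refine Finset.sum_congr rfl fun i _ => ?_
      change (Fintype.card (Fin (n + 1)) : ℝ)⁻¹ • (v i : E) = _
      rw [Fintype.card_fin, Nat.cast_succ]
    rw [hb]
    simp only [smul_sub, Finset.sum_sub_distrib, Finset.sum_const, Finset.card_univ,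
      Fintype.card_fin]
    rw [← Nat.cast_smul_eq_nsmul ℝ, smul_smul]
    push_cast
    rw [mul_inv_cancel₀ (by positivity), one_smul]
  rw [dist_eq_norm, h1, ← Finset.add_sum_erase _ _ (Finset.mem_univ j), sub_self, smul_zero,
    zero_add]
  calc ‖∑ i ∈ Finset.univ.erase j, ((n : ℝ) + 1)⁻¹ • ((v j : E) - v i)‖
      ≤ ∑ i ∈ Finset.univ.erase j, ((n : ℝ) + 1)⁻¹ * δ := by
        refine norm_sum_le_of_le _ fun i _ => ?_
        rw [norm_smul, Real.norm_of_nonneg (by positivity), ← dist_eq_norm]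
        exact mul_le_mul_of_nonneg_left (hv j i) (by positivity)
    _ = (n / (n + 1) : ℝ) * δ := by
        rw [Finset.sum_const, Finset.card_erase_of_mem (Finset.mem_univ j), Finset.card_univ,
          Fintype.card_fin, Nat.add_sub_cancel, nsmul_eq_mul]
        ring
    _ ≤ (N / (N + 1) : ℝ) * δ := by
        refine mul_le_mul_of_nonneg_right ?_ hδ
        have : (n : ℝ) ≤ N := by exact_mod_cast hn
        rw [div_le_div_iff₀ (by positivity) (by positivity)]
        nlinarith

/-- The hull condition is carried through the induction because it controls the distance from the
new apex to the vertices of the subdivided boundary. Here `n` is the length of the tuple, hence the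
bound `N + 1`. -/
theorem subdiv_tup_mem_mesh (hs : Convex ℝ s) (N : ℕ) : ∀ (n : ℕ), n ≤ N + 1 →
    ∀ (v : Fin n → s) {δ : ℝ}, 0 ≤ δ → (∀ i j, dist (v i) (v j) ≤ δ) →
      subdiv (bary hs) n (tup v) ∈ chainsOf fun w : Fin n → s =>
        (∀ i, (w i : E) ∈ convexHull ℝ (Set.range fun j => (v j : E))) ∧
          ∀ i j, dist (w i) (w j) ≤ (N / (N + 1) : ℝ) * δ
  | 0, _, v, δ, _, _ => tup_mem_chainsOf ⟨fun i => i.elim0, fun i => i.elim0⟩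
  | n + 1, hn, v, δ, hδ, hv => by
    have hbd : subdiv (bary hs) n (bdry (tup v)) ∈ chainsOf fun w : Fin n → s =>
        (∀ i, (w i : E) ∈ convexHull ℝ (Set.range fun j => (v j : E))) ∧
          ∀ i j, dist (w i) (w j) ≤ (N / (N + 1) : ℝ) * δ := by
      rw [bdry_tup, map_sum]
      refine AddSubgroup.sum_mem _ fun i _ => ?_
      rw [map_zsmul]
      refine AddSubgroup.zsmul_mem _ ?_ _
      refine chainsOf_mono ?_ (subdiv_tup_mem_mesh hs N n (by omega) (v ∘ i.succAbove) hδ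
        fun _ _ => hv _ _)
      rintro w ⟨h1, h2⟩
      refine ⟨fun j => convexHull_mono ?_ (h1 j), h2⟩
      rintro _ ⟨j, rfl⟩
      exact ⟨_, rfl⟩
    have hb : (bary hs n v : E) ∈ convexHull ℝ (Set.range fun j => (v j : E)) :=
      join_mem hs v (convex_convexHull ℝ _)
        (fun i => subset_convexHull ℝ _ (Set.mem_range_self i)) _
    -- Balls are convex, so bounding the distance from the barycenter to the original vertices
    -- bounds it on their whole hull.
    have hball : convexHull ℝ (Set.range fun j => (v j : E)) ⊆
        Metric.closedBall (bary hs n v : E) ((N / (N + 1) : ℝ) * δ) := by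
      refine convexHull_min ?_ (convex_closedBall _ _)
      rintro _ ⟨j, rfl⟩
      exact dist_bary_le hs (by omega) v hv j
    rw [subdiv_tup]
    refine cone_mem_chainsOf ?_ hbd
    rintro w ⟨h1, h2⟩
    have h3 : ∀ j, dist (w j) (bary hs n v) ≤ (N / (N + 1) : ℝ) * δ := fun j => hball (h1 j)
    constructor
    · intro i
      refine Fin.cases ?_ (fun j => ?_) i
      · simpa using hb
      · simpa using h1 j
    · intro i j
      refine Fin.cases ?_ (fun i => ?_) i <;> refine Fin.cases ?_ (fun j => ?_) j
      · simpa using by positivity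
      · simpa [dist_comm] using h3 j
      · simpa using h3 i
      · simpa using h2 i j

theorem iterSubdiv_mem_mesh (hs : Convex ℝ s) (N m : ℕ) (v : Fin (N + 1) → s) {δ : ℝ}
    (hδ : 0 ≤ δ) (hv : ∀ i j, dist (v i) (v j) ≤ δ) :
    iterSubdiv (bary hs) (N + 1) m (tup v) ∈ chainsOf fun w : Fin (N + 1) → s =>
      ∀ i j, dist (w i) (w j) ≤ (N / (N + 1) : ℝ) ^ m * δ := by
  induction m with
  | zero => exact tup_mem_chainsOf (by simpa using hv)
  | succ m ih =>
    rw [iterSubdiv_succ]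
    refine map_mem_of_mem_chainsOf (subdiv (bary hs) (N + 1)) (fun w hw => ?_) ih
    refine chainsOf_mono ?_ (subdiv_tup_mem_mesh hs N (N + 1) le_rfl w (by positivity) hw)
    rintro w' ⟨-, h⟩ i j
    refine (h i j).trans_eq ?_
    rw [pow_succ]
    ring

end mesh

/-! ### Acyclicity of cochains that vanish on small simplices -/

section small

variable {E : Type*} [NormedAddCommGroup E] [NormedSpace ℝ E] {s : Set E}
  {Y : Type*} [TopologicalSpace Y]

/-- The tuples contained in a convex set that is mapped into `U` or into `V`. -/
def IsSmallTuple (U V : Set Y) (σ : C(s, Y)) {n : ℕ} (w : Fin n → s) : Prop :=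
  ∃ A : Set E, Convex ℝ A ∧ (∀ i, (w i : E) ∈ A) ∧
    ((∀ x : s, (x : E) ∈ A → σ x ∈ U) ∨ ∀ x : s, (x : E) ∈ A → σ x ∈ V)

/-- All cone points used are vertices or barycenters, hence stay in the convex set that witnesses
smallness. -/
theorem subdivHomotopy_mem_small (hs : Convex ℝ s) {U V : Set Y} (σ : C(s, Y)) (n : ℕ)
    {c : VChain s n} (hc : c ∈ chainsOf (IsSmallTuple U V σ)) :
    subdivHomotopy (bary hs) n c ∈ chainsOf (IsSmallTuple U V σ) := by
  refine map_mem_of_mem_chainsOf (subdivHomotopy (bary hs) n) ?_ hc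
  rintro w ⟨A, hA, hw, hU⟩
  refine chainsOf_mono (P := fun w => ∀ i, w i ∈ {x : s | (x : E) ∈ A})
    (fun w' hw' => ⟨A, hA, hw', hU⟩) ?_
  exact subdivHomotopy_mem_chainsIn (fun n v hv => join_mem hs v hA hv _) n (tup_mem_chainsOf hw)

theorem subdiv_mem_small (hs : Convex ℝ s) {U V : Set Y} (σ : C(s, Y)) (n : ℕ)
    {c : VChain s n} (hc : c ∈ chainsOf (IsSmallTuple U V σ)) :
    subdiv (bary hs) n c ∈ chainsOf (IsSmallTuple U V σ) := by
  refine map_mem_of_mem_chainsOf (subdiv (bary hs) n) ?_ hc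
  rintro w ⟨A, hA, hw, hU⟩
  refine chainsOf_mono (P := fun w => ∀ i, w i ∈ {x : s | (x : E) ∈ A})
    (fun w' hw' => ⟨A, hA, hw', hU⟩) ?_
  exact subdiv_mem_chainsIn (fun n v hv => join_mem hs v hA hv _) n (tup_mem_chainsOf hw)

theorem iterHomotopy_mem_small (hs : Convex ℝ s) {U V : Set Y} (σ : C(s, Y)) (n m : ℕ)
    {c : VChain s n} (hc : c ∈ chainsOf (IsSmallTuple U V σ)) :
    iterHomotopy (bary hs) n m c ∈ chainsOf (IsSmallTuple U V σ) := by
  have hit : ∀ m, iterSubdiv (bary hs) n m c ∈ chainsOf (IsSmallTuple U V σ) := by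
    intro m
    induction m with
    | zero => exact hc
    | succ m ih => exact subdiv_mem_small hs σ n ih
  induction m with
  | zero => exact AddSubgroup.zero_mem _
  | succ m ih =>
    exact AddSubgroup.add_mem _ ih (subdivHomotopy_mem_small hs σ n (hit m))

theorem ev_eq_zero_of_small {R : Type*} [AddCommGroup R] (hs : Convex ℝ s) {U V : Set Y} {k : ℕ}
    {f : C(stdSimplex ℝ (Fin (k + 1)), Y) → R} (hU : ∀ τ, (∀ x, τ x ∈ U) → f τ = 0)
    (hV : ∀ τ, (∀ x, τ x ∈ V) → f τ = 0) (σ : C(s, Y)) {c : VChain s (k + 1)}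
    (hc : c ∈ chainsOf (IsSmallTuple U V σ)) : ev hs f σ c = 0 := by
  refine (AddSubgroup.mem_bot).1 (map_mem_of_mem_chainsOf (H := ⊥) (ev hs f σ) ?_ hc)
  rintro w ⟨A, hA, hw, h⟩
  rw [AddSubgroup.mem_bot, ev_tup]
  rcases h with h | h
  · exact hU _ fun x => h _ (join_mem hs w hA hw x)
  · exact hV _ fun x => h _ (join_mem hs w hA hw x)

/-- Once the mesh is below a Lebesgue number of the pulled back cover, each tuple lies in a ball,
which is convex, around its first vertex. Having this for all large `M` lets a simplex and its faces
share one exponent. -/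
theorem exists_iterSubdiv_mem_small [CompactSpace s] (hs : Convex ℝ s) {U V : Set Y}
    (hU : IsOpen U) (hV : IsOpen V) (hUV : U ∪ V = Set.univ) (σ : C(s, Y)) (n : ℕ)
    (v : Fin (n + 1) → s) :
    ∃ m, ∀ M, m ≤ M →
      iterSubdiv (bary hs) (n + 1) M (tup v) ∈ chainsOf (IsSmallTuple U V σ) := by
  obtain ⟨δ, hδ, hball⟩ := lebesgue_number_lemma_of_metric (s := (Set.univ : Set s))
    (c := fun b : Bool => σ ⁻¹' (if b then U else V)) isCompact_univ
    (fun b => by cases b <;> simp [hU.preimage σ.continuous, hV.preimage σ.continuous])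
    (fun x _ => by
      have : σ x ∈ U ∪ V := hUV ▸ Set.mem_univ _
      rcases this with h | h
      · exact Set.mem_iUnion.2 ⟨true, by simpa using h⟩
      · exact Set.mem_iUnion.2 ⟨false, by simpa using h⟩)
  obtain ⟨D, hD⟩ : ∃ D, ∀ p : Fin (n + 1) × Fin (n + 1), dist (v p.1) (v p.2) ≤ D := by
    obtain ⟨D, hD⟩ := (Set.finite_range
      fun p : Fin (n + 1) × Fin (n + 1) => dist (v p.1) (v p.2)).bddAbove
    exact ⟨D, fun p => hD ⟨p, rfl⟩⟩
  have hD0 : 0 ≤ D := dist_nonneg.trans (hD (0, 0))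
  have hlim : Filter.Tendsto (fun m : ℕ => (n / (n + 1) : ℝ) ^ m * D) Filter.atTop (nhds 0) := by
    have := (tendsto_pow_atTop_nhds_zero_of_lt_one (r := (n / (n + 1) : ℝ)) (by positivity)
      (by rw [div_lt_one (by positivity)]; linarith)).mul_const D
    rwa [zero_mul] at this
  obtain ⟨m, hm⟩ := Filter.eventually_atTop.1 (hlim.eventually (gt_mem_nhds hδ))
  refine ⟨m, fun M hM => ?_⟩
  refine chainsOf_mono ?_ (iterSubdiv_mem_mesh hs n M v hD0 fun i j => hD (i, j))
  intro w hw
  obtain ⟨b, hb⟩ := hball (w 0) (Set.mem_univ _)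
  refine ⟨Metric.ball (w 0 : E) δ, convex_ball _ _, fun i => (hw i 0).trans_lt (hm M hM), ?_⟩
  cases b
  · exact Or.inr fun x hx => by simpa using hb (show x ∈ Metric.ball (w 0) δ from hx)
  · exact Or.inl fun x hx => by simpa using hb (show x ∈ Metric.ball (w 0) δ from hx)

end small

/-- A cocycle that vanishes on the simplices of `U` and of `V`, where `U` and `V` form an open
cover, is the coboundary of a cochain with the same property. -/
theorem exists_natCoboundary_eq {R : Type*} [AddCommGroup R] {Y : Type*} [TopologicalSpace Y]
    {U V : Set Y} (hU : IsOpen U) (hV : IsOpen V) (hUV : U ∪ V = Set.univ) {n : ℕ}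
    (γ : C(stdSimplex ℝ (Fin (n + 2)), Y) → R) (hγ : natCoboundary γ = 0)
    (hγU : ∀ τ, (∀ x, τ x ∈ U) → γ τ = 0) (hγV : ∀ τ, (∀ x, τ x ∈ V) → γ τ = 0) :
    ∃ θ : C(stdSimplex ℝ (Fin (n + 1)), Y) → R, natCoboundary θ = γ ∧
      (∀ τ, (∀ x, τ x ∈ U) → θ τ = 0) ∧ ∀ τ, (∀ x, τ x ∈ V) → θ τ = 0 := by
  have hs := fun k : ℕ => convex_stdSimplex ℝ (Fin (k + 1))
  -- The number of subdivisions depends on the simplex, so `σ ↦ Sd^{m σ} σ` is not a chain map. The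
  -- definition of `θ` uses the homotopy instead.
  choose m hm using fun σ : C(stdSimplex ℝ (Fin (n + 1)), Y) =>
    exists_iterSubdiv_mem_small (hs n) hU hV hUV σ n (verts n)
  let θ : C(stdSimplex ℝ (Fin (n + 1)), Y) → R := fun σ =>
    ev (hs n) γ σ (iterHomotopy (bary (hs n)) (n + 1) (m σ) (tup (verts n)))
  -- Beyond `m σ` each further summand of the homotopy is a small chain, on which `γ` vanishes.
  have hθ : ∀ σ M, m σ ≤ M →
      ev (hs n) γ σ (iterHomotopy (bary (hs n)) (n + 1) M (tup (verts n))) = θ σ := by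
    intro σ M hM
    induction M, hM using Nat.le_induction with
    | base => rfl
    | succ M hM ih =>
      rw [iterHomotopy_succ, map_add, ih, add_eq_left]
      exact ev_eq_zero_of_small (hs n) hγU hγV σ
        (subdivHomotopy_mem_small (hs n) σ _ (hm σ M hM))
  refine ⟨θ, ?_, fun τ hτ => ?_, fun τ hτ => ?_⟩
  · funext τ
    obtain ⟨m', hm'⟩ := exists_iterSubdiv_mem_small (hs (n + 1)) hU hV hUV τ (n + 1)
      (verts (n + 1))
    -- One exponent that is large enough for `τ` and for all its faces.
    let M := m' + ∑ i, m (τ.comp (faceInclusion i))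
    have hM : ∀ i, m (τ.comp (faceInclusion i)) ≤ M := fun i =>
      (Finset.single_le_sum (f := fun i => m (τ.comp (faceInclusion i)))
        (fun _ _ => Nat.zero_le _) (Finset.mem_univ i)).trans (Nat.le_add_left _ _)
    have h1 : natCoboundary θ τ = ev (hs (n + 1)) γ τ
        (iterHomotopy (bary (hs (n + 1))) (n + 1) M (bdry (tup (verts (n + 1))))) := by
      rw [bdry_tup, map_sum, map_sum]
      refine Finset.sum_congr rfl fun i _ => ?_
      rw [map_zsmul, map_zsmul, ← hθ _ M (hM i), ev_comp (isAffine_faceInclusion i),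
        vmap_iterHomotopy _ (isAffine_faceInclusion i).map_bary, vmap_tup,
        faceInclusion_comp_verts]
    -- Evaluating `γ` on `∂T = 1 - Sd^M - T∂`: the left side is zero as `γ` is a cocycle, the
    -- subdivided term is small, and the last term is `dθ`.
    have h2 := bdry_iterHomotopy (b := bary (hs (n + 1))) (n + 1) M (tup (verts (n + 1)))
    have h3 := congrArg (ev (hs (n + 1)) γ τ) h2
    rw [ev_bdry, map_sub, map_sub, ev_verts, ← h1, ev_eq_zero_of_small (hs (n + 1)) hγU hγV τ
      (hm' M (Nat.le_add_right _ _)), hγ] at h3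
    rw [ev_zero, sub_zero] at h3
    exact (sub_eq_zero.1 h3.symm).symm
  · exact ev_eq_zero_of_small (hs n) hγU hγV τ (iterHomotopy_mem_small (hs n) τ _ _
      (tup_mem_chainsOf ⟨Set.univ, convex_univ, fun _ => trivial, Or.inl fun x _ => hτ x⟩))
  · exact ev_eq_zero_of_small (hs n) hγU hγV τ (iterHomotopy_mem_small (hs n) τ _ _
      (tup_mem_chainsOf ⟨Set.univ, convex_univ, fun _ => trivial, Or.inr fun x _ => hτ x⟩))

/-! ### The prism operator -/

section prism

/-- The prism over the standard simplex, as a convex set. -/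
def prismSet (n : ℕ) : Set ((Fin (n + 1) → ℝ) × ℝ) :=
  stdSimplex ℝ (Fin (n + 1)) ×ˢ Set.Icc (0 : ℝ) 1

theorem convex_prismSet (n : ℕ) : Convex ℝ (prismSet n) :=
  (convex_stdSimplex ℝ _).prod (convex_Icc 0 1)

/-- The inclusion of the standard simplex into the prism at height `t`. -/
def prismIncl (n : ℕ) (t : unitInterval) : C(stdSimplex ℝ (Fin (n + 1)), prismSet n) where
  toFun x := ⟨(x, t), x.2, t.2⟩
  continuous_toFun := by fun_prop

def prismToProd (n : ℕ) : C(prismSet n, stdSimplex ℝ (Fin (n + 1)) × unitInterval) where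
  toFun z := (⟨z.1.1, z.2.1⟩, ⟨z.1.2, z.2.2⟩)
  continuous_toFun := by fun_prop

/-- The inclusion of a prism as a face of the next one. -/
def prismFace {n : ℕ} (i : Fin (n + 2)) : C(prismSet n, prismSet (n + 1)) where
  toFun z := ⟨(faceInclusion i ⟨z.1.1, z.2.1⟩, z.1.2), (faceInclusion i _).2, z.2.2⟩
  continuous_toFun := by fun_prop

theorem isAffine_prismIncl (n : ℕ) (t : unitInterval) :
    IsAffine (convex_stdSimplex ℝ _) (convex_prismSet n) (prismIncl n t) := by
  -- The constant height `t` is linear on the simplex since it equals `t` times the sum of the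
  -- barycentric coordinates.
  refine isAffine_of_linear _ _ _
    (LinearMap.prod LinearMap.id ((t : ℝ) • ∑ i, LinearMap.proj i)) fun x => ?_
  refine Prod.ext rfl ?_
  have hx : ∑ i, x.1 i = 1 := x.2.2
  simp only [LinearMap.prod_apply, Function.prod, LinearMap.smul_apply, LinearMap.sum_apply,
    LinearMap.proj_apply, hx]
  exact (mul_one (t : ℝ)).symm

theorem isAffine_prismFace {n : ℕ} (i : Fin (n + 2)) :
    IsAffine (convex_prismSet n) (convex_prismSet (n + 1)) (prismFace i) :=
  isAffine_of_linear _ _ _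
    ((FunOnFinite.linearMap ℝ ℝ i.succAbove).prodMap LinearMap.id) fun _ => rfl

/-- The triangulation of the prisms over the tuples of points of the standard simplex. -/
def prismChain (n k : ℕ) : VChain (stdSimplex ℝ (Fin (n + 1))) k →+ VChain (prismSet n) (k + 1) :=
  coneHomotopy (fun _ => vmap (prismIncl n 1)) (fun _ => vmap (prismIncl n 0))
    (fun _ v => prismIncl n 0 (v 0)) k

theorem bdry_prismChain (n k : ℕ) (c : VChain (stdSimplex ℝ (Fin (n + 1))) (k + 1)) :
    bdry (prismChain n (k + 1) c) =
      vmap (prismIncl n 1) c - vmap (prismIncl n 0) c - prismChain n k (bdry c) :=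
  bdry_coneHomotopy (f := fun _ => vmap (prismIncl n 1)) (g := fun _ => vmap (prismIncl n 0))
    (fun _ _ => (vmap_bdry _ _).symm) (fun _ _ => (vmap_bdry _ _).symm)
    (VChain.hom_congr fun v => by
      rw [vmap_tup, vmap_tup]; exact congrArg tup (Subsingleton.elim _ _)) k c

theorem vmap_vmap {K L M : Type*} (φ : K → L) (ψ : L → M) {n : ℕ} (c : VChain K n) :
    vmap ψ (vmap φ c) = vmap (ψ ∘ φ) c := by
  refine VChain.hom_congr (f := (vmap ψ).comp (vmap φ)) (g := vmap (ψ ∘ φ)) (fun v => ?_) c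
  rw [AddMonoidHom.comp_apply, vmap_tup, vmap_tup, vmap_tup, Function.comp_assoc]

theorem vmap_prismChain {n : ℕ} (i : Fin (n + 2)) (k : ℕ)
    (c : VChain (stdSimplex ℝ (Fin (n + 1))) k) :
    vmap (prismFace i) (prismChain n k c) = prismChain (n + 1) k (vmap (faceInclusion i) c) := by
  refine vmap_coneHomotopy (f := fun _ => vmap (prismIncl n 1))
    (g := fun _ => vmap (prismIncl n 0)) (f' := fun _ => vmap (prismIncl (n + 1) 1))
    (g' := fun _ => vmap (prismIncl (n + 1) 0)) (faceInclusion i) (prismFace i)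
    (fun _ c => ?_) (fun _ c => ?_) (fun _ _ => rfl) k c
  · rw [vmap_vmap, vmap_vmap]; rfl
  · rw [vmap_vmap, vmap_vmap]; rfl

variable {R : Type*} [AddCommGroup R] {X Y : Type*} [TopologicalSpace X] [TopologicalSpace Y]

/-- The map at time `t` of a homotopy. -/
def slice (F : C(X × unitInterval, Y)) (t : unitInterval) : C(X, Y) :=
  F.comp ((ContinuousMap.id X).prodMk (ContinuousMap.const X t))

/-- The prism spanned by a simplex under a homotopy. -/
def prismMap (F : C(X × unitInterval, Y)) {n : ℕ} (σ : C(stdSimplex ℝ (Fin (n + 1)), X)) :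
    C(prismSet n, Y) :=
  F.comp ((σ.prodMap (ContinuousMap.id unitInterval)).comp (prismToProd n))

/-- The prism operator on cochains. -/
def natPrism (F : C(X × unitInterval, Y)) {n : ℕ} (f : C(stdSimplex ℝ (Fin (n + 2)), Y) → R)
    (σ : C(stdSimplex ℝ (Fin (n + 1)), X)) : R :=
  ev (convex_prismSet n) f (prismMap F σ) (prismChain n (n + 1) (tup (verts n)))

theorem natPrism_natCoboundary (F : C(X × unitInterval, Y)) {n : ℕ}
    (f : C(stdSimplex ℝ (Fin (n + 1)), Y) → R) (τ : C(stdSimplex ℝ (Fin (n + 1)), X)) :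
    natPrism F (natCoboundary f) τ = f ((slice F 1).comp τ) - f ((slice F 0).comp τ) -
      ev (convex_prismSet n) f (prismMap F τ) (prismChain n n (bdry (tup (verts n)))) := by
  rw [natPrism, ← ev_bdry, bdry_prismChain, map_sub, map_sub, ← ev_comp (isAffine_prismIncl n 1),
    ← ev_comp (isAffine_prismIncl n 0), ev_verts, ev_verts]
  rfl

/-- The boundary of a vertex is the empty tuple, over which the prism is zero, so there is no second
term. -/
theorem natPrism_homotopy_zero (F : C(X × unitInterval, Y))
    (f : C(stdSimplex ℝ (Fin 1), Y) → R) (τ : C(stdSimplex ℝ (Fin 1), X)) :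
    natPrism F (natCoboundary f) τ = f ((slice F 1).comp τ) - f ((slice F 0).comp τ) := by
  rw [natPrism_natCoboundary, sub_eq_self]
  exact map_zero _

theorem natPrism_homotopy_succ (F : C(X × unitInterval, Y)) {n : ℕ}
    (f : C(stdSimplex ℝ (Fin (n + 2)), Y) → R) (τ : C(stdSimplex ℝ (Fin (n + 2)), X)) :
    natCoboundary (natPrism F f) τ + natPrism F (natCoboundary f) τ =
      f ((slice F 1).comp τ) - f ((slice F 0).comp τ) := by
  rw [natPrism_natCoboundary, ← eq_sub_iff_add_eq, sub_sub_cancel, bdry_tup, map_sum, map_sum]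
  refine Finset.sum_congr rfl fun i _ => ?_
  rw [map_zsmul, map_zsmul, ← faceInclusion_comp_verts, ← vmap_tup, ← vmap_prismChain,
    ← ev_comp (isAffine_prismFace i)]
  rfl

end prism

/-! ### Cochains graded by the integers -/

section cochains

variable {R : Type*} [AddCommGroup R] {X Y Z : Type*} [TopologicalSpace X] [TopologicalSpace Y]
  [TopologicalSpace Z]

theorem d_negSucc (n : ℕ) (q : ℤ) (h : Int.negSucc n + 1 = q) (f : Cochain R X (Int.negSucc n)) :
    d R X (Int.negSucc n) q h f = 0 := by
  subst h
  rfl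

instance (n : ℕ) : IsEmpty (SingularSimplex X (Int.negSucc n)) :=
  inferInstanceAs (IsEmpty PEmpty)

theorem d_d (p q r : ℤ) (h : p + 1 = q) (h' : q + 1 = r) (f : Cochain R X p) :
    d R X q r h' (d R X p q h f) = 0 := by
  cases p with
  | ofNat n =>
    obtain rfl : q = Int.ofNat (n + 1) := h.symm
    obtain rfl : r = Int.ofNat (n + 2) := h'.symm
    exact natCoboundary_natCoboundary f
  | negSucc n => rw [d_negSucc, map_zero]

/-- The cochain homotopy between the two ends of a homotopy. -/
def prism (R : Type*) [AddCommGroup R] (F : C(X × unitInterval, Y)) :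
    (p q : ℤ) → p + 1 = q → Cochain R Y q → Cochain R X p
  | Int.ofNat n, _, rfl => fun f => natPrism (n := n) F f
  | Int.negSucc _, _, rfl => fun _ => 0

theorem d_prism (F : C(X × unitInterval, Y)) (p q r : ℤ) (h : p + 1 = q) (h' : q + 1 = r)
    (f : Cochain R Y q) :
    d R X p q h (prism R F p q h f) + prism R F q r h' (d R Y q r h' f) =
      Cochain.pull (slice F 1) q f - Cochain.pull (slice F 0) q f := by
  cases q with
  | negSucc n => exact funext fun σ => isEmptyElim σ
  | ofNat n =>
    obtain rfl : r = Int.ofNat (n + 1) := h'.symm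
    cases n with
    | zero =>
      obtain rfl : p = Int.negSucc 0 := by
        have : p + 1 = 0 := h
        rw [Int.negSucc_eq]
        omega
      rw [d_negSucc, zero_add]
      exact funext fun τ => natPrism_homotopy_zero F f τ
    | succ n =>
      obtain rfl : p = Int.ofNat n := by
        simp only [Int.ofNat_eq_natCast] at h ⊢
        push_cast at h
        omega
      exact funext fun τ => natPrism_homotopy_succ F f τ

theorem prism_comp_left (F : C(X × unitInterval, Y)) (g : C(Y, Z)) (p q : ℤ) (h : p + 1 = q)
    (f : Cochain R Z q) :
    prism R (g.comp F) p q h f = prism R F p q h (Cochain.pull g q f) := by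
  subst h
  cases p <;> rfl

theorem prism_comp_right (F : C(Y × unitInterval, Z)) (g : C(X, Y)) (p q : ℤ) (h : p + 1 = q)
    (f : Cochain R Z q) :
    prism R (F.comp (g.prodMap (ContinuousMap.id _))) p q h f =
      Cochain.pull g p (prism R F p q h f) := by
  subst h
  cases p <;> rfl

theorem prism_zero (F : C(X × unitInterval, Y)) (p q : ℤ) (h : p + 1 = q) :
    prism R F p q h 0 = 0 := by
  subst h
  cases p with
  | ofNat n => exact funext fun σ => ev_zero _ _ _
  | negSucc n => rfl

theorem pull_comp (f : C(X, Y)) (g : C(Y, Z)) (p : ℤ) (c : Cochain R Z p) :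
    Cochain.pull (g.comp f) p c = Cochain.pull f p (Cochain.pull g p c) := by
  cases p with
  | ofNat n => rfl
  | negSucc n => exact funext fun σ => isEmptyElim σ

theorem pull_id (p : ℤ) (c : Cochain R X p) : Cochain.pull (ContinuousMap.id X) p c = c := by
  cases p with
  | ofNat n => rfl
  | negSucc n => exact funext fun σ => isEmptyElim σ

theorem SingularSimplex.map_injective {f : C(X, Y)} (hf : Function.Injective f) (p : ℤ) :
    Function.Injective (SingularSimplex.map f p) := by
  cases p with
  | ofNat n => exact fun _ _ h => (ContinuousMap.cancel_left hf).1 h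
  | negSucc n => exact Function.injective_of_subsingleton _

/-- Cochains are arbitrary functions on simplices, so they extend by zero from a subspace. -/
theorem pull_surjective {f : C(X, Y)} (hf : Function.Injective f) (p : ℤ) :
    Function.Surjective (Cochain.pull (R := R) f p) := fun c =>
  ⟨Function.extend (SingularSimplex.map f p) c 0,
    funext fun σ => (SingularSimplex.map_injective hf p).extend_apply _ _ σ⟩

/-- The inclusion of a subspace. -/
abbrev incl (A : Set X) : C(A, X) := ⟨Subtype.val, continuous_subtype_val⟩

theorem pull_incl_eq_zero_iff {A : Set X} {n : ℕ} (c : Cochain R X (Int.ofNat n)) :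
    Cochain.pull (incl A) (Int.ofNat n) c = 0 ↔
      ∀ σ : C(stdSimplex ℝ (Fin (n + 1)), X), (∀ x, σ x ∈ A) → c σ = 0 := by
  constructor
  · intro h σ hσ
    exact congrFun h (⟨fun x => ⟨σ x, hσ x⟩, by fun_prop⟩ : C(stdSimplex ℝ (Fin (n + 1)), A))
  · intro h
    refine funext fun (σ : C(stdSimplex ℝ (Fin (n + 1)), A)) => ?_
    exact h ((incl A).comp σ) fun x => (σ x).2

theorem exists_glue {U V : Set X} {p : ℤ} (a : Cochain R U p) (b : Cochain R V p)
    (hab : Cochain.pull (ContinuousMap.inclusion Set.inter_subset_left) p a =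
      Cochain.pull (ContinuousMap.inclusion (Set.inter_subset_right : U ∩ V ⊆ V)) p b) :
    ∃ c : Cochain R X p, Cochain.pull (incl U) p c = a ∧ Cochain.pull (incl V) p c = b := by
  cases p with
  | negSucc n => exact ⟨0, funext fun σ => isEmptyElim σ, funext fun σ => isEmptyElim σ⟩
  | ofNat n =>
    classical
    obtain ⟨b', rfl⟩ := pull_surjective (f := incl V) Subtype.val_injective _ b
    obtain ⟨a', rfl⟩ := pull_surjective (f := incl U) Subtype.val_injective _ a
    refine ⟨fun σ : C(stdSimplex ℝ (Fin (n + 1)), X) => if ∀ x, σ x ∈ U then a' σ else b' σ,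
      funext fun (σ : C(stdSimplex ℝ (Fin (n + 1)), U)) => ?_,
      funext fun (σ : C(stdSimplex ℝ (Fin (n + 1)), V)) => ?_⟩
    · exact if_pos fun x => (σ x).2
    · change (if _ then _ else _) = _
      split_ifs with h
      · exact congrFun hab (⟨fun x => ⟨σ x, h x, (σ x).2⟩, by fun_prop⟩ :
          C(stdSimplex ℝ (Fin (n + 1)), ↥(U ∩ V)))
      · rfl

/-- A cocycle that vanishes on both members of an open cover is the coboundary of a cochain
that vanishes on both members. -/
theorem exists_d_eq {U V : Set X} (hU : IsOpen U) (hV : IsOpen V) (hUV : U ∪ V = Set.univ)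
    {p q r : ℤ} (h : p + 1 = q) (h' : q + 1 = r) (γ : Cochain R X q) (hγ : d R X q r h' γ = 0)
    (hγU : Cochain.pull (incl U) q γ = 0) (hγV : Cochain.pull (incl V) q γ = 0) :
    ∃ θ : Cochain R X p, d R X p q h θ = γ ∧ Cochain.pull (incl U) p θ = 0 ∧
      Cochain.pull (incl V) p θ = 0 := by
  cases q with
  | negSucc n =>
    exact ⟨0, funext fun σ => isEmptyElim σ, map_zero _, map_zero _⟩
  | ofNat n =>
    rw [pull_incl_eq_zero_iff] at hγU hγV
    obtain rfl : r = Int.ofNat (n + 1) := h'.symm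
    cases n with
    | zero =>
      -- In degree zero no subdivision is needed: each point lies in `U` or in `V`, so the cocycle
      -- itself is zero.
      refine ⟨0, ?_, map_zero _, map_zero _⟩
      rw [map_zero]
      refine funext fun (σ : C(stdSimplex ℝ (Fin 1), X)) => ?_
      have : σ default ∈ U ∪ V := hUV ▸ Set.mem_univ _
      rcases this with h | h
      · exact (hγU σ fun x => by rwa [Subsingleton.elim x default]).symm
      · exact (hγV σ fun x => by rwa [Subsingleton.elim x default]).symm
    | succ n =>
      obtain rfl : p = Int.ofNat n := by
        simp only [Int.ofNat_eq_natCast] at h ⊢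
        push_cast at h
        omega
      obtain ⟨θ, h1, h2, h3⟩ := exists_natCoboundary_eq hU hV hUV γ hγ hγU hγV
      exact ⟨θ, h1, (pull_incl_eq_zero_iff _).2 h2, (pull_incl_eq_zero_iff _).2 h3⟩

end cochains

/-! ### Cohomology classes -/

section classes

variable {R : Type*} [AddCommGroup R] {X Y Z : Type*} [TopologicalSpace X] [TopologicalSpace Y]
  [TopologicalSpace Z]

theorem mem_cocycles_iff {p q : ℤ} (h : p + 1 = q) {c : Cochain R X p} :
    c ∈ cocycles R X p ↔ d R X p q h c = 0 := by
  subst h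
  exact Iff.rfl

theorem cls_surjective {p : ℤ} (a : Cohomology R X p) : ∃ c : cocycles R X p, cls c = a :=
  QuotientAddGroup.mk_surjective a

theorem cls_eq_zero_iff {p q : ℤ} (h : p + 1 = q) (c : cocycles R X q) :
    cls c = 0 ↔ ∃ b : Cochain R X p, d R X p q h b = c := by
  obtain rfl : p = q - 1 := by omega
  rw [cls, QuotientAddGroup.eq_zero_iff]
  exact Iff.rfl

theorem cls_sub {p : ℤ} (c c' : cocycles R X p) : cls (c - c') = cls c - cls c' := rfl

theorem pull_mem_cocycles (f : C(X, Y)) {p : ℤ} {c : Cochain R Y p} (hc : c ∈ cocycles R Y p) :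
    Cochain.pull f p c ∈ cocycles R X p := by
  rw [mem_cocycles_iff rfl] at hc ⊢
  rw [d_pull, hc, map_zero]

theorem pullback_cls (f : C(X, Y)) {p : ℤ} (c : cocycles R Y p) :
    pullback f p (cls c) = cls ⟨Cochain.pull f p c, pull_mem_cocycles f c.2⟩ := rfl

theorem pullback_comp (f : C(X, Y)) (g : C(Y, Z)) (p : ℤ) (a : Cohomology R Z p) :
    pullback (g.comp f) p a = pullback f p (pullback g p a) := by
  obtain ⟨c, rfl⟩ := cls_surjective a
  simp only [pullback_cls, pull_comp]

theorem pullback_id (p : ℤ) (a : Cohomology R X p) : pullback (ContinuousMap.id X) p a = a := by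
  obtain ⟨c, rfl⟩ := cls_surjective a
  rw [pullback_cls]
  exact congrArg cls (Subtype.ext (pull_id p _))

theorem pullback_slice (F : C(X × unitInterval, Y)) (p : ℤ) (a : Cohomology R Y p) :
    pullback (slice F 0) p a = pullback (slice F 1) p a := by
  obtain ⟨c, rfl⟩ := cls_surjective a
  rw [eq_comm, ← sub_eq_zero, pullback_cls, pullback_cls, ← cls_sub,
    cls_eq_zero_iff (sub_add_cancel p 1)]
  refine ⟨prism R F _ _ (sub_add_cancel p 1) c, ?_⟩
  have h := d_prism F (p - 1) p (p + 1) (sub_add_cancel p 1) rfl (c : Cochain R Y p)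
  rw [(mem_cocycles_iff rfl).1 c.2, prism_zero, add_zero] at h
  exact h

theorem pullback_eq_of_homotopy {f g : C(X, Y)} (F : C(X × unitInterval, Y))
    (hf : ∀ x, F (x, 0) = f x) (hg : ∀ x, F (x, 1) = g x) (p : ℤ) (a : Cohomology R Y p) :
    pullback f p a = pullback g p a := by
  obtain rfl : slice F 0 = f := ContinuousMap.ext hf
  obtain rfl : slice F 1 = g := ContinuousMap.ext hg
  exact pullback_slice F p a

/-- The restriction of a continuous map to subspaces. -/
abbrev restr (f : C(X, Y)) {A : Set X} {B : Set Y} (h : Set.MapsTo f A B) : C(A, B) :=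
  ⟨h.restrict f A B, f.continuous.restrict h⟩

end classes

/-! ### Disjoint unions -/

section sum

variable {R : Type*} [AddCommGroup R] {X Y : Type*} [TopologicalSpace X] [TopologicalSpace Y]

abbrev sumInl (X Y : Type*) [TopologicalSpace X] [TopologicalSpace Y] : C(X, X ⊕ Y) :=
  ⟨Sum.inl, continuous_inl⟩

abbrev sumInr (X Y : Type*) [TopologicalSpace X] [TopologicalSpace Y] : C(Y, X ⊕ Y) :=
  ⟨Sum.inr, continuous_inr⟩

/-- The standard simplex is connected, so each singular simplex lies in one of the two summands. -/
theorem cochain_eq_zero_of_sum {p : ℤ} {c : Cochain R (X ⊕ Y) p}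
    (hl : Cochain.pull (sumInl X Y) p c = 0) (hr : Cochain.pull (sumInr X Y) p c = 0) : c = 0 := by
  cases p with
  | negSucc n => exact funext fun σ => isEmptyElim σ
  | ofNat n =>
    refine funext fun (σ : C(stdSimplex ℝ (Fin (n + 1)), X ⊕ Y)) => ?_
    have hclopen : IsClopen (σ ⁻¹' Set.range Sum.inl) :=
      ⟨isClosed_range_inl.preimage σ.continuous, isOpen_range_inl.preimage σ.continuous⟩
    rcases isClopen_iff.1 hclopen with h | h
    · have h' : ∀ x, ∃ y, σ x = Sum.inr y := by
        intro x
        rcases hx : σ x with a | b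
        · exact absurd (show x ∈ σ ⁻¹' Set.range Sum.inl from ⟨a, hx.symm⟩) (h ▸ Set.notMem_empty x)
        · exact ⟨b, rfl⟩
      obtain ⟨y₀, -⟩ := h' (stdSimplex.vertex 0)
      let τ : C(stdSimplex ℝ (Fin (n + 1)), Y) :=
        ⟨fun x => Sum.elim (fun _ => y₀) id (σ x),
          (continuous_const.sumElim continuous_id).comp σ.continuous⟩
      have hτ : (sumInr X Y).comp τ = σ := by
        ext1 x
        obtain ⟨y, hy⟩ := h' x
        simp [τ, hy]
      rw [← hτ]
      exact congrFun hr τ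
    · have h' : ∀ x, ∃ y, σ x = Sum.inl y := by
        intro x
        obtain ⟨y, hy⟩ : x ∈ σ ⁻¹' Set.range Sum.inl := h ▸ Set.mem_univ x
        exact ⟨y, hy.symm⟩
      obtain ⟨y₀, -⟩ := h' (stdSimplex.vertex 0)
      let τ : C(stdSimplex ℝ (Fin (n + 1)), X) :=
        ⟨fun x => Sum.elim id (fun _ => y₀) (σ x),
          (continuous_id.sumElim continuous_const).comp σ.continuous⟩
      have hτ : (sumInl X Y).comp τ = σ := by
        ext1 x
        obtain ⟨y, hy⟩ := h' x
        simp [τ, hy]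
      rw [← hτ]
      exact congrFun hl τ

theorem exists_cochain_sum {p : ℤ} (a : Cochain R X p) (b : Cochain R Y p) :
    ∃ c : Cochain R (X ⊕ Y) p,
      Cochain.pull (sumInl X Y) p c = a ∧ Cochain.pull (sumInr X Y) p c = b := by
  cases p with
  | negSucc n => exact ⟨0, funext fun σ => isEmptyElim σ, funext fun σ => isEmptyElim σ⟩
  | ofNat n =>
    classical
    obtain ⟨a', rfl⟩ := pull_surjective (f := sumInl X Y) Sum.inl_injective _ a
    obtain ⟨b', rfl⟩ := pull_surjective (f := sumInr X Y) Sum.inr_injective _ b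
    refine ⟨fun σ : C(stdSimplex ℝ (Fin (n + 1)), X ⊕ Y) =>
      if (σ (stdSimplex.vertex 0)).isLeft then a' σ else b' σ, ?_, ?_⟩
    · exact funext fun (σ : C(stdSimplex ℝ (Fin (n + 1)), X)) =>
        if_pos (e := b' ((sumInl X Y).comp σ))
          (show (Sum.inl (σ (stdSimplex.vertex 0)) : X ⊕ Y).isLeft = true from rfl)
    · exact funext fun (σ : C(stdSimplex ℝ (Fin (n + 1)), Y)) => 
        if_neg (t := a' ((sumInr X Y).comp σ)) Bool.false_ne_true

theorem exists_class_sum {p : ℤ} (a : Cohomology R X p) (b : Cohomology R Y p) :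
    ∃ c : Cohomology R (X ⊕ Y) p,
      pullback (sumInl X Y) p c = a ∧ pullback (sumInr X Y) p c = b := by
  obtain ⟨a, rfl⟩ := cls_surjective a
  obtain ⟨b, rfl⟩ := cls_surjective b
  obtain ⟨c, ha, hb⟩ := exists_cochain_sum (a : Cochain R X p) (b : Cochain R Y p)
  have hc : c ∈ cocycles R (X ⊕ Y) p := by
    rw [mem_cocycles_iff rfl]
    refine cochain_eq_zero_of_sum ?_ ?_
    · rw [← d_pull, ha]; exact a.2
    · rw [← d_pull, hb]; exact b.2
  refine ⟨cls ⟨c, hc⟩, ?_, ?_⟩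
  · rw [pullback_cls]; exact congrArg cls (Subtype.ext ha)
  · rw [pullback_cls]; exact congrArg cls (Subtype.ext hb)

end sum

/-! ### The Mayer–Vietoris connecting relation -/

section mv

variable {R : Type*} [AddCommGroup R] {Y Y' : Type*} [TopologicalSpace Y] [TopologicalSpace Y']
  {U V : Set Y} {p q : ℤ} {h : p + 1 = q}

theorem IsMVConnecting.sub {a a' : Cohomology R ↥(U ∩ V) p} {b b' : Cohomology R Y q}
    (hab : IsMVConnecting U V h a b) (hab' : IsMVConnecting U V h a' b') :
    IsMVConnecting U V h (a - a') (b - b') := by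
  obtain ⟨α, β, κ, γ, h1, h2, h3, rfl, rfl⟩ := hab
  obtain ⟨α', β', κ', γ', h1', h2', h3', rfl, rfl⟩ := hab'
  refine ⟨α - α', β - β', κ - κ', γ - γ', ?_, ?_, ?_, rfl, rfl⟩
  · rw [map_sub, h1, h1', AddSubgroup.coe_sub, map_sub]
  · rw [map_sub, h2, h2', AddSubgroup.coe_sub, map_sub]
  · rw [AddSubgroup.coe_sub, h3, h3', map_sub, map_sub]
    abel

/-- Two local primitives of a cocycle whose difference is exact glue to a primitive. -/
theorem IsMVConnecting.eq_zero (hU : IsOpen U) (hV : IsOpen V) (hUV : U ∪ V = Set.univ)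
    {b : Cohomology R Y q} (hb : IsMVConnecting U V h 0 b) : b = 0 := by
  obtain ⟨α, β, κ, γ, h1, h2, h3, hκ, rfl⟩ := hb
  obtain ⟨l, hl⟩ := (cls_eq_zero_iff (sub_add_cancel p 1) κ).1 hκ
  obtain ⟨l, rfl⟩ := pull_surjective
    (f := ContinuousMap.inclusion (Set.inter_subset_left : U ∩ V ⊆ U))
    (Set.inclusion_injective Set.inter_subset_left) _ l
  -- Correcting `α` by the coboundary of an extension of `l` makes the two local primitives agree on
  -- `U ∩ V`.
  obtain ⟨ζ, hζU, hζV⟩ := exists_glue (α - d R U _ _ (sub_add_cancel p 1) l) β (by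
    rw [map_sub, ← d_pull, hl, h3, sub_sub_cancel])
  have hγ := (mem_cocycles_iff rfl).1 γ.2
  -- `dζ` equals `γ` only on simplices inside `U` or inside `V`; the difference is exact by the
  -- theorem on small simplices.
  obtain ⟨θ, hθ, -⟩ := exists_d_eq hU hV hUV h rfl ((γ : Cochain R Y q) - d R Y p q h ζ)
    (by rw [map_sub, d_d, sub_zero, hγ])
    (by rw [map_sub, ← d_pull, hζU, map_sub, d_d, sub_zero, h1, sub_self])
    (by rw [map_sub, ← d_pull, hζV, h2, sub_self])
  rw [cls_eq_zero_iff h]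
  exact ⟨θ + ζ, by rw [map_add, hθ, sub_add_cancel]⟩

theorem IsMVConnecting.unique (hU : IsOpen U) (hV : IsOpen V) (hUV : U ∪ V = Set.univ)
    {a : Cohomology R ↥(U ∩ V) p} {b b' : Cohomology R Y q}
    (hb : IsMVConnecting U V h a b) (hb' : IsMVConnecting U V h a b') : b = b' := by
  have := hb.sub hb'
  rw [sub_self] at this
  exact sub_eq_zero.1 (this.eq_zero hU hV hUV)

theorem IsMVConnecting.exists (hU : IsOpen U) (hV : IsOpen V) (hUV : U ∪ V = Set.univ)
    (h : p + 1 = q) (a : Cohomology R ↥(U ∩ V) p) : ∃ b, IsMVConnecting U V h a b := by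
  obtain ⟨κ, rfl⟩ := cls_surjective a
  obtain ⟨α, hα⟩ := pull_surjective
    (f := ContinuousMap.inclusion (Set.inter_subset_left : U ∩ V ⊆ U))
    (Set.inclusion_injective Set.inter_subset_left) _ (κ : Cochain R ↥(U ∩ V) p)
  obtain ⟨g, hgU, hgV⟩ := exists_glue (d R U p q h α) (0 : Cochain R V q) (by
    rw [← d_pull, hα, map_zero]; exact (mem_cocycles_iff h).1 κ.2)
  -- The glued cochain `g` is closed only on small simplices. Subtracting `θ` makes it a cocycle
  -- without changing its restrictions to `U` and `V`.
  obtain ⟨θ, hθ, hθU, hθV⟩ := exists_d_eq hU hV hUV (r := q + 1 + 1) rfl rfl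
    (d R Y q (q + 1) rfl g) (d_d _ _ _ _ _ _) (by rw [← d_pull, hgU, d_d])
    (by rw [← d_pull, hgV, map_zero])
  refine ⟨cls ⟨g - θ, (mem_cocycles_iff rfl).2 (by rw [map_sub, hθ, sub_self])⟩,
    α, 0, κ, _, ?_, ?_, ?_, rfl, rfl⟩
  · rw [map_sub, hgU, hθU, sub_zero]
  · rw [map_sub, hgV, hθV, sub_zero, map_zero]
  · rw [hα, map_zero, sub_zero]

theorem IsMVConnecting.exists_of_restrict (h : p + 1 = q) {b : Cohomology R Y q}
    (hU : pullback (incl U) q b = 0) (hV : pullback (incl V) q b = 0) :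
    ∃ a, IsMVConnecting U V h a b := by
  obtain ⟨γ, rfl⟩ := cls_surjective b
  rw [pullback_cls, cls_eq_zero_iff h] at hU hV
  obtain ⟨α, hα⟩ := hU
  obtain ⟨β, hβ⟩ := hV
  refine ⟨_, α, β, ⟨_, ?_⟩, γ, hα, hβ, rfl, rfl, rfl⟩
  rw [mem_cocycles_iff h, map_sub, d_pull, d_pull, hα, hβ]
  simp only
  rw [← pull_comp, ← pull_comp, sub_eq_zero]
  rfl

theorem IsMVConnecting.restrict_left {a : Cohomology R ↥(U ∩ V) p} {b : Cohomology R Y q}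
    (hab : IsMVConnecting U V h a b) : pullback (incl U) q b = 0 := by
  obtain ⟨α, β, κ, γ, h1, h2, h3, rfl, rfl⟩ := hab
  rw [pullback_cls, cls_eq_zero_iff h]
  exact ⟨α, h1⟩

theorem IsMVConnecting.naturality {U' V' : Set Y'} (f : C(Y', Y)) (hU : Set.MapsTo f U' U)
    (hV : Set.MapsTo f V' V) {a : Cohomology R ↥(U ∩ V) p} {b : Cohomology R Y q}
    (hab : IsMVConnecting U V h a b) :
    IsMVConnecting U' V' h (pullback (restr f (hU.inter_inter hV)) p a)
      (pullback f q b) := by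
  obtain ⟨α, β, κ, γ, h1, h2, h3, rfl, rfl⟩ := hab
  refine ⟨Cochain.pull (restr f hU) p α, Cochain.pull (restr f hV) p β,
    ⟨_, pull_mem_cocycles _ κ.2⟩, ⟨_, pull_mem_cocycles f γ.2⟩, ?_, ?_, ?_, rfl, rfl⟩
  · rw [d_pull, h1]
    rw [← pull_comp, ← pull_comp]
    rfl
  · rw [d_pull, h2]
    rw [← pull_comp, ← pull_comp]
    rfl
  · change Cochain.pull (restr f (hU.inter_inter hV)) p (κ : Cochain R ↥(U ∩ V) p) = _
    rw [h3, map_sub, ← pull_comp, ← pull_comp, ← pull_comp, ← pull_comp]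
    rfl

theorem IsMVConnecting.of_left (h : p + 1 = q) (x : Cohomology R U p) :
    IsMVConnecting U V h
      (pullback (ContinuousMap.inclusion Set.inter_subset_left) p x)
      (0 : Cohomology R Y q) := by
  obtain ⟨α, rfl⟩ := cls_surjective x
  refine ⟨α, 0, _, 0, ?_, ?_, ?_, rfl, rfl⟩
  · exact ((mem_cocycles_iff h).1 α.2).trans (map_zero _).symm
  · exact (map_zero _).trans (map_zero _).symm
  · simp

/-- Subtracting the restrictions of a global primitive of `γ` turns `α` and `β` into cocycles with
the same difference. -/
theorem IsMVConnecting.exists_of_zero {a : Cohomology R ↥(U ∩ V) p}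
    (ha : IsMVConnecting U V h a (0 : Cohomology R Y q)) :
    ∃ (x : Cohomology R U p) (y : Cohomology R V p),
      a = pullback (ContinuousMap.inclusion Set.inter_subset_left) p x -
        pullback (ContinuousMap.inclusion Set.inter_subset_right) p y := by
  obtain ⟨α, β, κ, γ, h1, h2, h3, rfl, hγ⟩ := ha
  obtain ⟨θ, hθ⟩ := (cls_eq_zero_iff h γ).1 hγ
  refine ⟨cls ⟨α - Cochain.pull (incl U) p θ, (mem_cocycles_iff h).2 ?_⟩,
    cls ⟨β - Cochain.pull (incl V) p θ, (mem_cocycles_iff h).2 ?_⟩, ?_⟩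
  · rw [map_sub, d_pull, hθ, h1, sub_self]
  · rw [map_sub, d_pull, hθ, h2, sub_self]
  · rw [pullback_cls, pullback_cls, ← cls_sub]
    refine congrArg cls (Subtype.ext ?_)
    rw [AddSubgroup.coe_sub, h3]
    simp only [map_sub, ← pull_comp]
    exact (sub_sub_sub_cancel_right _ _ _).symm

end mv

/-! ### The double mapping cylinder of a cover by two sets -/

section cyl

variable {Y : Type*}

/-- The double mapping cylinder of `V ← U ∩ V → U`, as a subspace of `Y × [0, 1]`. -/
def cyl (U V : Set Y) : Set (Y × unitInterval) :=
  {z | (0 < z.2 → z.1 ∈ U) ∧ (z.2 < 1 → z.1 ∈ V)}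

variable (U V : Set Y)

/-- The height coordinate separates the ends, which is what the original cover may lack. The overlap
with `cylV` is the part over the open middle third and lies over `U ∩ V`. -/
def cylU : Set (cyl U V) := {z | (1 / 3 : ℝ) < z.1.2}

def cylV : Set (cyl U V) := {z | (z.1.2 : ℝ) < 2 / 3}

theorem cylU_union_cylV : cylU U V ∪ cylV U V = Set.univ := by
  refine Set.eq_univ_of_forall fun z => ?_
  by_cases h : (1 / 3 : ℝ) < z.1.2
  · exact Or.inl h
  · exact Or.inr (show (z.1.2 : ℝ) < 2 / 3 by linarith)

variable [TopologicalSpace Y]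

def cylProj : C(cyl U V, Y) := ⟨fun z => z.1.1, by fun_prop⟩

theorem isOpen_cylU : IsOpen (cylU U V) := isOpen_lt continuous_const (by fun_prop)

theorem isOpen_cylV : IsOpen (cylV U V) := isOpen_lt (by fun_prop) continuous_const

theorem mapsTo_cylProj_cylU : Set.MapsTo (cylProj U V) (cylU U V) U := fun z hz =>
  z.2.1 (show (0 : ℝ) < z.1.2 from lt_trans (by norm_num) hz)

theorem mapsTo_cylProj_cylV : Set.MapsTo (cylProj U V) (cylV U V) V := fun z hz =>
  z.2.2 (show (z.1.2 : ℝ) < 1 from lt_trans hz (by norm_num))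

variable {U V} {R : Type*} [AddCommGroup R]

/-- The projection of the double mapping cylinder of an open cover is injective on cohomology. -/
theorem pullback_cylProj_injective (hU : IsOpen U) (hV : IsOpen V) (hUV : U ∪ V = Set.univ)
    {q : ℤ} {b : Cohomology R Y q} (hb : pullback (cylProj U V) q b = 0) : b = 0 := by
  have hq : q - 1 + 1 = q := sub_add_cancel q 1
  obtain ⟨γ, rfl⟩ := cls_surjective b
  rw [pullback_cls, cls_eq_zero_iff hq] at hb
  obtain ⟨θ, hθ⟩ := hb
  simp only at hθ
  -- The two ends of the cylinder restrict `θ` to primitives of `γ` on `U` and `V`, and over `U ∩ V`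
  -- the ends are joined by the homotopy `F`.
  let sU : C(U, cyl U V) :=
    ⟨fun y => ⟨(y, 1), fun _ => y.2, fun h => (lt_irrefl _ h).elim⟩, by fun_prop⟩
  let sV : C(V, cyl U V) :=
    ⟨fun y => ⟨(y, 0), fun h => (lt_irrefl _ h).elim, fun _ => y.2⟩, by fun_prop⟩
  let F : C(↥(U ∩ V) × unitInterval, cyl U V) :=
    ⟨fun z => ⟨(z.1, z.2), fun _ => z.1.2.1, fun _ => z.1.2.2⟩, by fun_prop⟩
  -- The prism of a constant homotopy is closed but need not vanish on unnormalized cochains. It is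
  -- the discrepancy between the two primitives up to a coboundary, and is absorbed in the one on
  -- `V`.
  let Q : Cochain R Y (q - 1) := prism R ContinuousMap.fst (q - 1) q hq γ
  have hQ : d R Y (q - 1) q hq Q = 0 := by
    have := d_prism (R := R) (ContinuousMap.fst : C(Y × unitInterval, Y)) (q - 1) q (q + 1) hq
      rfl γ
    rw [(mem_cocycles_iff rfl).1 γ.2, prism_zero, add_zero] at this
    exact this.trans (sub_self _)
  refine IsMVConnecting.eq_zero (h := hq) hU hV hUV
    ⟨Cochain.pull sU _ θ, Cochain.pull sV _ θ + Cochain.pull (incl V) _ Q,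
      ⟨d R _ (q - 1 - 1) (q - 1) (sub_add_cancel _ 1) (prism R F _ _ (sub_add_cancel _ 1) θ),
        (mem_cocycles_iff hq).2 (d_d _ _ _ _ _ _)⟩, γ, ?_, ?_, ?_,
      (cls_eq_zero_iff (sub_add_cancel _ 1) _).2 ⟨_, rfl⟩, rfl⟩
  · rw [d_pull, hθ, ← pull_comp]
    rfl
  · rw [map_add, d_pull, d_pull, hQ, map_zero, add_zero, hθ, ← pull_comp]
    rfl
  · have h1 := d_prism F (q - 1 - 1) (q - 1) q (sub_add_cancel _ 1) hq θ
    have h2 : prism R F (q - 1) q hq (Cochain.pull (cylProj U V) q (γ : Cochain R Y q)) =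
        Cochain.pull (incl (U ∩ V)) _ Q := by
      rw [← prism_comp_left, ← prism_comp_right]
      rfl
    rw [hθ, h2] at h1
    rw [map_add, ← pull_comp, ← pull_comp, ← pull_comp]
    simp only
    rw [eq_sub_of_add_eq h1, sub_sub]
    rfl

end cyl

/-! ### The suspension -/

section suspension

theorem Suspension.upper_union_lower (X : Type*) :
    Suspension.upper X ∪ Suspension.lower X = Set.univ := by
  refine Set.eq_univ_of_forall fun z => ?_
  rcases eq_or_ne z.height 0 with h | h
  · exact Or.inr (show z.height < 1 by rw [h]; exact zero_lt_one)
  · exact Or.inl (show 0 < z.height from unitInterval.pos_iff_ne_zero.2 h)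

variable (X : Type*) [TopologicalSpace X]

theorem Suspension.continuous_height : Continuous (Suspension.height (X := X)) :=
  continuous_quot_lift _ continuous_snd

theorem Suspension.isOpen_upper : IsOpen (Suspension.upper X) :=
  isOpen_lt continuous_const (Suspension.continuous_height X)

theorem Suspension.isOpen_lower : IsOpen (Suspension.lower X) :=
  isOpen_lt (Suspension.continuous_height X) continuous_const

/-- The base coordinate of the points of the suspension that are not cone points. -/
def Suspension.base {X : Type*} : Suspension X → Option X :=
  Quot.lift (fun z => open Classical in if 0 < z.2 ∧ z.2 < 1 then some z.1 else none) (by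
    rintro a b (⟨ha, hb⟩ | ⟨ha, hb⟩) <;> simp [ha, hb])

/-- Over an open set a quotient map restricts to a quotient map, so the base coordinate is
continuous away from the cone points. The retraction extends classes from the equator to the overlap
of the cones. -/
theorem Suspension.exists_retraction :
    ∃ ρ : C(↥(Suspension.upper X ∩ Suspension.lower X), X),
      ∀ x, ρ (Suspension.equator X x) = x := by
  have hbase : ∀ z : ↥(Suspension.upper X ∩ Suspension.lower X), z.1.base.isSome := by
    rintro ⟨⟨x, t⟩, h1, h2⟩
    exact (congrArg Option.isSome (if_pos ⟨h1, h2⟩)).trans rfl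
  have hopen := (Suspension.isOpen_upper X).inter (Suspension.isOpen_lower X)
  have hquot : Topology.IsQuotientMap
      (Quot.mk (suspensionRel X) : X × unitInterval → Suspension X) :=
    isQuotientMap_quot_mk
  have hq := hquot.restrictPreimage_isOpen hopen
  refine ⟨⟨fun z => z.1.base.get (hbase z), hq.continuous_iff.2 ?_⟩, fun x => ?_⟩
  · refine (continuous_fst.comp continuous_subtype_val).congr fun z => ?_
    refine (Option.get_of_eq_some _ ?_).symm
    exact if_pos z.2
  · refine Option.get_of_eq_some _ ?_
    exact if_pos (Suspension.equator X x).2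

variable {X} {R : Type*} [AddCommGroup R]

theorem IsSuspension.exists {p q : ℤ} (h : p + 1 = q) (a : Cohomology R X p) :
    ∃ b, IsSuspension h a b := by
  obtain ⟨ρ, hρ⟩ := Suspension.exists_retraction X
  obtain ⟨b, hb⟩ := IsMVConnecting.exists (Suspension.isOpen_upper X) (Suspension.isOpen_lower X)
    (Suspension.upper_union_lower X) h (pullback ρ p a)
  refine ⟨b, _, ?_, hb⟩
  rw [← pullback_comp, show ρ.comp (Suspension.equator X) = ContinuousMap.id X from
    ContinuousMap.ext hρ, pullback_id]

end suspension

/-! ### The map from the double mapping cylinder to a suspension -/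

section collapse

variable {Y : Type u} (U V : Set Y)

/-- The height of the image in the suspension of a point of the cylinder. -/
def cylHeight (t : unitInterval) : unitInterval := Set.projIcc (0 : ℝ) 1 zero_le_one (3 * t - 1)

theorem continuous_cylHeight : Continuous cylHeight :=
  continuous_projIcc.comp (by fun_prop)

theorem cylHeight_eq_zero {t : unitInterval} (h : (t : ℝ) < 1 / 3) : cylHeight t = 0 :=
  Set.projIcc_of_le_left _ (by linarith)

theorem cylHeight_eq_one {t : unitInterval} (h : (2 / 3 : ℝ) < t) : cylHeight t = 1 :=
  Set.projIcc_of_right_le _ (by linarith)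

theorem cylHeight_pos {t : unitInterval} (h : (1 / 3 : ℝ) < t) : 0 < cylHeight t := by
  change (0 : ℝ) < max 0 (min 1 (3 * (t : ℝ) - 1))
  exact lt_max_of_lt_right (lt_min one_pos (by linarith))

theorem cylHeight_lt_one {t : unitInterval} (h : (t : ℝ) < 2 / 3) : cylHeight t < 1 := by
  change max 0 (min 1 (3 * (t : ℝ) - 1)) < (1 : ℝ)
  exact max_lt one_pos (min_lt_of_right_lt (by linarith))

/-- The map from the double mapping cylinder to the suspension of `U ∩ V` with a disjoint
base point that collapses the two ends. -/
def collapseFun (z : cyl U V) : Suspension (↥(U ∩ V) ⊕ PUnit.{u + 1}) :=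
  Quot.mk _ (open Classical in
    if h : z.1.1 ∈ U ∩ V then Sum.inl ⟨z.1.1, h⟩ else Sum.inr PUnit.unit, cylHeight z.1.2)

theorem mem_inter_of_mem_cyl {z : cyl U V} (h0 : 0 < z.1.2) (h1 : z.1.2 < 1) : z.1.1 ∈ U ∩ V :=
  ⟨z.2.1 h0, z.2.2 h1⟩

theorem collapseFun_of_mem {z : cyl U V} (h : z.1.1 ∈ U ∩ V) :
    collapseFun U V z = Quot.mk _ (Sum.inl ⟨z.1.1, h⟩, cylHeight z.1.2) := by
  rw [collapseFun, dif_pos h]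

variable [TopologicalSpace Y]

/-- The height is constant near both ends, so the map is locally constant there, whatever base
coordinate is chosen. For `0 < t < 1` the point lies over `U ∩ V` and the formula is continuous. -/
theorem continuous_collapseFun : Continuous (collapseFun U V) := by
  have ht : Continuous fun z : cyl U V => (z.1.2 : ℝ) := by fun_prop
  refine continuous_iff_continuousAt.2 fun z => ?_
  rcases lt_or_ge (z.1.2 : ℝ) (1 / 3) with h | h
  · refine ContinuousAt.congr (f := fun _ => Quot.mk _ (Sum.inr PUnit.unit, 0))
      continuousAt_const ?_
    filter_upwards [(isOpen_lt ht continuous_const).mem_nhds h] with y hy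
    exact Quot.sound (Or.inl ⟨rfl, cylHeight_eq_zero hy⟩)
  rcases lt_or_ge (2 / 3) (z.1.2 : ℝ) with h' | h'
  · refine ContinuousAt.congr (f := fun _ => Quot.mk _ (Sum.inr PUnit.unit, 1))
      continuousAt_const ?_
    filter_upwards [(isOpen_lt continuous_const ht).mem_nhds h'] with y hy
    exact Quot.sound (Or.inr ⟨rfl, cylHeight_eq_one hy⟩)
  have hO : IsOpen {y : cyl U V | 0 < y.1.2 ∧ y.1.2 < 1} :=
    (isOpen_lt continuous_const (by fun_prop)).inter (isOpen_lt (by fun_prop) continuous_const)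
  refine ContinuousOn.continuousAt ?_ (hO.mem_nhds
    ⟨show (0 : ℝ) < z.1.2 by linarith, show (z.1.2 : ℝ) < 1 by linarith⟩)
  rw [continuousOn_iff_continuous_domRestrict]
  have hc : Continuous fun y : {y : cyl U V | 0 < y.1.2 ∧ y.1.2 < 1} =>
      (Quot.mk _ (Sum.inl ⟨y.1.1.1, mem_inter_of_mem_cyl U V y.2.1 y.2.2⟩, cylHeight y.1.1.2) :
        Suspension (↥(U ∩ V) ⊕ PUnit.{u + 1})) := by
    refine continuous_quot_mk.comp (Continuous.prodMk (continuous_inl.comp ?_)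
      (continuous_cylHeight.comp (by fun_prop)))
    fun_prop
  exact hc.congr fun y => (collapseFun_of_mem U V _).symm

def collapse : C(cyl U V, Suspension (↥(U ∩ V) ⊕ PUnit.{u + 1})) :=
  ⟨collapseFun U V, continuous_collapseFun U V⟩

variable {U V} {R : Type*} [AddCommGroup R]

/-- The collapse map carries the two parts of the cylinder into the two open cones. On the overlap
it is homotopic to the projection followed by the equator, by moving the height linearly to `1/2`
strictly between `0` and `1`. -/
theorem IsSuspension.collapse {p q : ℤ} {h : p + 1 = q}
    {a : Cohomology R (↥(U ∩ V) ⊕ PUnit.{u + 1}) p}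
    {b : Cohomology R (Suspension (↥(U ∩ V) ⊕ PUnit.{u + 1})) q} (hab : IsSuspension h a b) :
    IsMVConnecting (cylU U V) (cylV U V) h
      (pullback (restr (cylProj U V)
        ((mapsTo_cylProj_cylU U V).inter_inter (mapsTo_cylProj_cylV U V))) p
          (pullback (sumInl _ _) p a))
      (pullback (collapse U V) q b) := by
  obtain ⟨a', rfl, hb⟩ := hab
  have hU : Set.MapsTo (TCWeight.collapse U V) (cylU U V) (Suspension.upper _) :=
    fun z hz => cylHeight_pos hz
  have hV : Set.MapsTo (TCWeight.collapse U V) (cylV U V) (Suspension.lower _) :=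
    fun z hz => cylHeight_lt_one hz
  convert hb.naturality (TCWeight.collapse U V) hU hV using 1
  rw [← pullback_comp, ← pullback_comp, eq_comm]
  have hmem : ∀ z : ↥(cylU U V ∩ cylV U V), z.1.1.1 ∈ U ∩ V := fun z =>
    ⟨mapsTo_cylProj_cylU U V z.2.1, mapsTo_cylProj_cylV U V z.2.2⟩
  let H : ↥(cylU U V ∩ cylV U V) × unitInterval → unitInterval := fun z =>
    ⟨(1 - (z.2 : ℝ)) * cylHeight z.1.1.1.2 + z.2 * (1 / 2), by
      have h1 := z.2.2.1
      have h2 := z.2.2.2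
      have h3 := (cylHeight z.1.1.1.2).2.1
      have h4 := (cylHeight z.1.1.1.2).2.2
      constructor <;> nlinarith⟩
  have hHc : Continuous H := by
    refine Continuous.subtype_mk ?_ _
    have : Continuous fun z : ↥(cylU U V ∩ cylV U V) × unitInterval => cylHeight z.1.1.1.2 :=
      continuous_cylHeight.comp (by fun_prop)
    fun_prop
  have hH0 : ∀ z, 0 < H z := fun z => by
    have h1 := z.2.2.1
    have h2 := z.2.2.2
    have h3 : (0 : ℝ) < cylHeight z.1.1.1.2 := cylHeight_pos z.1.2.1
    change (0 : ℝ) < (1 - (z.2 : ℝ)) * cylHeight z.1.1.1.2 + z.2 * (1 / 2)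
    rcases h1.eq_or_lt with h | h
    · rw [← h]; linarith
    · nlinarith
  have hH1 : ∀ z, H z < 1 := fun z => by
    have h1 := z.2.2.1
    have h2 := z.2.2.2
    have h3 : (cylHeight z.1.1.1.2 : ℝ) < 1 := cylHeight_lt_one z.1.2.2
    change (1 - (z.2 : ℝ)) * cylHeight z.1.1.1.2 + z.2 * (1 / 2) < (1 : ℝ)
    rcases h1.eq_or_lt with h | h
    · rw [← h]; linarith
    · nlinarith
  refine pullback_eq_of_homotopy
    ⟨fun z => ⟨Quot.mk _ (Sum.inl ⟨z.1.1.1.1, hmem z.1⟩, H z), hH0 z, hH1 z⟩, ?_⟩ ?_ ?_ p a'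
  · refine Continuous.subtype_mk (continuous_quot_mk.comp (Continuous.prodMk
      (continuous_inl.comp ?_) hHc)) _
    fun_prop
  · intro z
    refine Subtype.ext ?_
    refine Eq.trans ?_ (collapseFun_of_mem U V (hmem z)).symm
    refine congrArg (fun t => Quot.mk _ (Sum.inl _, t)) (Subtype.ext ?_)
    change (1 - (0 : ℝ)) * cylHeight z.1.1.2 + 0 * (1 / 2) = cylHeight z.1.1.2
    ring
  · intro z
    refine Subtype.ext ?_
    refine congrArg (fun t => Quot.mk _ (Sum.inl _, t)) (Subtype.ext ?_)
    change (1 - (1 : ℝ)) * cylHeight z.1.1.2 + 1 * (1 / 2) = 1 / 2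
    ring

end collapse

/-! ### Stable operations and connecting homomorphisms -/

namespace StableOperation

variable {R : Type v} [AddCommGroup R] {S : Type w} [AddCommGroup S] {k : ℤ}
  (μ : StableOperation.{u} R S k)

/-- The zero class of a point suspends to zero, so `μ(0)` on the suspension must vanish on the upper
cone. Zero on any space is pulled back from there by a constant map. -/
theorem op_zero (X : Type u) [TopologicalSpace X] (p : ℤ) : μ.op X p 0 = 0 := by
  let P := PUnit.{u + 1}
  have hz : IsSuspension (R := R) (X := P) (sub_add_cancel p 1) 0 0 := by
    refine ⟨0, map_zero _, 0, 0, 0, 0, ?_, ?_, ?_, rfl, rfl⟩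
    · exact (map_zero _).trans (map_zero _).symm
    · exact (map_zero _).trans (map_zero _).symm
    · simp
  obtain ⟨a', -, h⟩ := μ.suspension P PUnit.unit _ _ _ 0 0 (AddSubgroup.zero_mem _) hz
  have h0 := h.restrict_left
  rw [← μ.natural, map_zero] at h0
  let x₀ : Suspension.upper P :=
    ⟨Quot.mk _ (PUnit.unit, 1), show (0 : unitInterval) < 1 from zero_lt_one⟩
  rw [← map_zero (pullback (ContinuousMap.const X x₀) p), μ.natural, h0, map_zero]

/-- On the cylinder `δ` is the suspension followed by the collapse map, so `μ` commutes with it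
there; injectivity of the projection to `Y` brings the relation back. -/
theorem connecting {Y : Type u} [TopologicalSpace Y] {U V : Set Y} (hU : IsOpen U) (hV : IsOpen V)
    (hUV : U ∪ V = Set.univ) {p q : ℤ} (h : p + 1 = q) (h' : p + k + 1 = q + k)
    {a : Cohomology R ↥(U ∩ V) p} {b : Cohomology R Y q} (hab : IsMVConnecting U V h a b) :
    IsMVConnecting U V h' (μ.op _ p a) (μ.op Y q b) := by
  -- Extension by zero over a disjoint base point makes any class reduced, as the suspension axiom
  -- requires.
  obtain ⟨a', ha', ha0⟩ := exists_class_sum a (0 : Cohomology R PUnit.{u + 1} p)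
  obtain ⟨b', hb'⟩ := IsSuspension.exists h a'
  have hred : a' ∈ reduced R (Sum.inr PUnit.unit : ↥(U ∩ V) ⊕ PUnit.{u + 1}) p := ha0
  have hμ := (μ.suspension _ _ p q h a' b' hred hb').collapse
  have hcyl := hb'.collapse
  rw [ha'] at hcyl
  have hbb : pullback (collapse U V) q b' = pullback (cylProj U V) q b :=
    hcyl.unique (isOpen_cylU U V) (isOpen_cylV U V) (cylU_union_cylV U V)
      (hab.naturality (cylProj U V) (mapsTo_cylProj_cylU U V) (mapsTo_cylProj_cylV U V))
  rw [← μ.natural, ha', ← μ.natural _ _ (collapse U V), hbb, μ.natural] at hμ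
  -- Some class `c` is related to `μ(a)` on `Y`; it agrees with `μ(b)` after pulling back to the
  -- cylinder, hence on `Y`.
  obtain ⟨c, hc⟩ := IsMVConnecting.exists hU hV hUV h' (μ.op _ p a)
  have hcb := hμ.unique (isOpen_cylU U V) (isOpen_cylV U V) (cylU_union_cylV U V)
    (hc.naturality (cylProj U V) (mapsTo_cylProj_cylU U V) (mapsTo_cylProj_cylV U V))
  rw [← sub_eq_zero, ← map_sub] at hcb
  rwa [sub_eq_zero.1 (pullback_cylProj_injective hU hV hUV hcb)]

end StableOperation

/-! ### The product with a circle

The punctured plane is covered by the complements of the two closed vertical half-axes. Their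
intersection has two components, and the points `(1, 0)` and `(-1, 0)` of different components can
be joined in either complement. -/

section loop

/-- The product of a space with the punctured plane. -/
abbrev LoopSpace (X : Type u) : Type u := X × {z : ℝ × ℝ // z ≠ 0}

def loopU (X : Type u) : Set (LoopSpace X) := {t | t.2.1.1 ≠ 0 ∨ 0 < t.2.1.2}

def loopV (X : Type u) : Set (LoopSpace X) := {t | t.2.1.1 ≠ 0 ∨ t.2.1.2 < 0}

theorem loopU_union_loopV (X : Type u) : loopU X ∪ loopV X = Set.univ := by
  refine Set.eq_univ_of_forall fun t => ?_
  by_cases h : t.2.1.1 = 0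
  · rcases lt_trichotomy t.2.1.2 0 with h' | h' | h'
    · exact Or.inr (Or.inr h')
    · exact absurd (Prod.ext h h') t.2.2
    · exact Or.inl (Or.inr h')
  · exact Or.inl (Or.inl h)

theorem ne_zero_of_mem_loop {X : Type u} {t : LoopSpace X} (ht : t ∈ loopU X ∩ loopV X) :
    t.2.1.1 ≠ 0 := by
  rcases ht with ⟨h | h, h' | h'⟩
  · exact h
  · exact h
  · exact h'
  · exact absurd h h'.not_gt

variable (X : Type u) [TopologicalSpace X]

theorem isOpen_loopU : IsOpen (loopU X) := by
  have h1 : Continuous fun t : LoopSpace X => t.2.1.1 := by fun_prop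
  have h2 : Continuous fun t : LoopSpace X => t.2.1.2 := by fun_prop
  exact (isOpen_ne_fun h1 continuous_const).union (isOpen_lt continuous_const h2)

theorem isOpen_loopV : IsOpen (loopV X) := by
  have h1 : Continuous fun t : LoopSpace X => t.2.1.1 := by fun_prop
  have h2 : Continuous fun t : LoopSpace X => t.2.1.2 := by fun_prop
  exact (isOpen_ne_fun h1 continuous_const).union (isOpen_lt h2 continuous_const)

/-- The inclusion of a fibre over a point of the horizontal axis. -/
def loopFibre (r : ℝ) (hr : r ≠ 0) : C(X, ↥(loopU X ∩ loopV X)) :=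
  ⟨fun x => ⟨(x, ⟨(r, 0), fun h => hr (congrArg Prod.fst h)⟩), Or.inl hr, Or.inl hr⟩, by fun_prop⟩

/-- The projection of the two components of the intersection to two copies of the space. -/
def loopSplit : C(↥(loopU X ∩ loopV X), X ⊕ X) where
  toFun t := open Classical in if 0 < t.1.2.1.1 then Sum.inl t.1.1 else Sum.inr t.1.1
  continuous_toFun := by
    have hc : Continuous fun t : ↥(loopU X ∩ loopV X) => t.1.2.1.1 := by fun_prop
    have hx : Continuous fun t : ↥(loopU X ∩ loopV X) => t.1.1 := by fun_prop
    refine continuous_iff_continuousAt.2 fun t => ?_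
    rcases (ne_zero_of_mem_loop t.2).lt_or_gt with h | h
    · refine ContinuousAt.congr (continuous_inr.comp hx).continuousAt ?_
      filter_upwards [(isOpen_lt hc continuous_const).mem_nhds h] with y hy
      exact (if_neg (lt_asymm hy)).symm
    · refine ContinuousAt.congr (continuous_inl.comp hx).continuousAt ?_
      filter_upwards [(isOpen_lt continuous_const hc).mem_nhds h] with y hy
      exact (if_pos hy).symm

theorem loopSplit_comp_fibre_one :
    (loopSplit X).comp (loopFibre X 1 one_ne_zero) = sumInl X X :=
  ContinuousMap.ext fun _ => if_pos one_pos

theorem loopSplit_comp_fibre_neg_one :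
    (loopSplit X).comp (loopFibre X (-1) (neg_ne_zero.2 one_ne_zero)) = sumInr X X :=
  ContinuousMap.ext fun _ => if_neg (by simp [loopFibre])

/-- The paths from `(1, 0)` to `(-1, 0)` through `(0, ε / 4)`. -/
def loopPath (ε : ℝ) (hε : ε ≠ 0) : C(X × unitInterval, LoopSpace X) :=
  ⟨fun z => (z.1, ⟨(1 - 2 * (z.2 : ℝ), ε * (z.2 * (1 - z.2))), fun h => by
    have h1 : 1 - 2 * (z.2 : ℝ) = 0 := congrArg Prod.fst h
    have h2 : ε * ((z.2 : ℝ) * (1 - z.2)) = 0 := congrArg Prod.snd h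
    have h3 : (z.2 : ℝ) = 1 / 2 := by linarith
    rw [h3] at h2
    norm_num at h2
    exact hε h2⟩), by fun_prop⟩

variable {X} {R : Type*} [AddCommGroup R] {p q : ℤ} {h : p + 1 = q}

/-- A class on the intersection that is annihilated by the connecting homomorphism has the same
restriction to the fibres over `(1, 0)` and `(-1, 0)`. -/
theorem IsMVConnecting.loop_eq {a : Cohomology R ↥(loopU X ∩ loopV X) p}
    (ha : IsMVConnecting (loopU X) (loopV X) h a (0 : Cohomology R (LoopSpace X) q)) :
    pullback (loopFibre X 1 one_ne_zero) p a =
      pullback (loopFibre X (-1) (neg_ne_zero.2 one_ne_zero)) p a := by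
  -- The path meets the vertical axis only at height `ε / 4`, so it stays in `loopU` for `ε = 1` and
  -- in `loopV` for `ε = -1`.
  have key : ∀ (z : X × unitInterval) (ε : ℝ) (hε : ε ≠ 0),
      (loopPath X ε hε z).2.1.1 ≠ 0 ∨ (loopPath X ε hε z).2.1.2 = ε / 4 := by
    intro z ε hε
    by_cases h : 1 - 2 * (z.2 : ℝ) = 0
    · right
      change ε * ((z.2 : ℝ) * (1 - z.2)) = ε / 4
      rw [show (z.2 : ℝ) = 1 / 2 by linarith]
      ring
    · exact Or.inl h
  -- By exactness the class is a difference of classes from `loopU` and `loopV`, and in each of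
  -- these sets the two fibres are homotopic.
  obtain ⟨x, y, rfl⟩ := ha.exists_of_zero
  rw [map_sub, map_sub, ← pullback_comp, ← pullback_comp, ← pullback_comp, ← pullback_comp]
  congr 1
  · refine pullback_eq_of_homotopy ⟨fun z => ⟨loopPath X 1 one_ne_zero z,
      (key z 1 one_ne_zero).imp_right fun h => by rw [h]; norm_num⟩,
      (loopPath X 1 one_ne_zero).continuous.subtype_mk _⟩ ?_ ?_ p x
    · intro z
      refine Subtype.ext (Prod.ext rfl (Subtype.ext (Prod.ext ?_ ?_)))
      · change 1 - 2 * (0 : ℝ) = 1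
        norm_num
      · change 1 * ((0 : ℝ) * (1 - 0)) = 0
        norm_num
    · intro z
      refine Subtype.ext (Prod.ext rfl (Subtype.ext (Prod.ext ?_ ?_)))
      · change 1 - 2 * (1 : ℝ) = -1
        norm_num
      · change 1 * ((1 : ℝ) * (1 - 1)) = 0
        norm_num
  · refine pullback_eq_of_homotopy ⟨fun z => ⟨loopPath X (-1) (neg_ne_zero.2 one_ne_zero) z,
      (key z (-1) (neg_ne_zero.2 one_ne_zero)).imp_right fun h => by rw [h]; norm_num⟩,
      (loopPath X (-1) _).continuous.subtype_mk _⟩ ?_ ?_ p y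
    · intro z
      refine Subtype.ext (Prod.ext rfl (Subtype.ext (Prod.ext ?_ ?_)))
      · change 1 - 2 * (0 : ℝ) = 1
        norm_num
      · change -1 * ((0 : ℝ) * (1 - 0)) = 0
        norm_num
    · intro z
      refine Subtype.ext (Prod.ext rfl (Subtype.ext (Prod.ext ?_ ?_)))
      · change 1 - 2 * (1 : ℝ) = -1
        norm_num
      · change -1 * ((1 : ℝ) * (1 - 1)) = 0
        norm_num

end loop

/-! ### Properties of stable operations -/

namespace StableOperation

variable {R : Type v} [AddCommGroup R] {S : Type w} [AddCommGroup S] {k : ℤ}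
  (μ : StableOperation.{u} R S k)

theorem pullback_op_loop {X : Type u} [TopologicalSpace X] {p : ℤ} (c : Cohomology R (X ⊕ X) p) :
    pullback (loopFibre X 1 one_ne_zero) (p + k) (μ.op _ p (pullback (loopSplit X) p c)) =
        μ.op X p (pullback (sumInl X X) p c) ∧
      pullback (loopFibre X (-1) (neg_ne_zero.2 one_ne_zero)) (p + k)
          (μ.op _ p (pullback (loopSplit X) p c)) =
        μ.op X p (pullback (sumInr X X) p c) := by
  constructor
  · rw [← μ.natural, ← pullback_comp, loopSplit_comp_fibre_one]
  · rw [← μ.natural, ← pullback_comp, loopSplit_comp_fibre_neg_one]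

/-- Stable operations are additive. -/
theorem op_sub {X : Type u} [TopologicalSpace X] {p : ℤ} (a b : Cohomology R X p) :
    μ.op X p (a - b) = μ.op X p a - μ.op X p b := by
  obtain ⟨c, hca, hcb⟩ := exists_class_sum a b
  let fold : C(X ⊕ X, X) := ⟨Sum.elim id id, continuous_id.sumElim continuous_id⟩
  have hl : pullback (sumInl X X) p (c - pullback fold p b) = a - b := by
    rw [map_sub, hca, ← pullback_comp]
    exact congrArg (a - ·) (pullback_id p b)
  have hr : pullback (sumInr X X) p (c - pullback fold p b) = 0 := by
    rw [map_sub, hcb, ← pullback_comp]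
    exact sub_eq_zero.2 (pullback_id p b).symm
  have hU := isOpen_loopU X
  have hV := isOpen_loopV X
  have hUV := loopU_union_loopV X
  obtain ⟨e, he⟩ := IsMVConnecting.exists hU hV hUV rfl (pullback (loopSplit X) p c)
  -- A pair of equal classes `(b, b)` extends over `loopU`, so it is killed by `δ`. Thus `(a, b)`
  -- and `(a - b, 0)` have the same image `e`.
  have hfold : pullback (loopSplit X) p (pullback fold p b) =
      pullback (ContinuousMap.inclusion (Set.inter_subset_left : loopU X ∩ loopV X ⊆ loopU X)) p
        (pullback (ContinuousMap.fst.comp (incl (loopU X))) p b) := by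
    rw [← pullback_comp, ← pullback_comp]
    refine congrArg (fun g => pullback g p b) (ContinuousMap.ext fun t => ?_)
    change Sum.elim id id (if _ then _ else _) = t.1.1
    split_ifs <;> rfl
  have he' : IsMVConnecting (loopU X) (loopV X) rfl
      (pullback (loopSplit X) p (c - pullback fold p b)) e := by
    have := he.sub (IsMVConnecting.of_left (V := loopV X) rfl
      (pullback (ContinuousMap.fst.comp (incl (loopU X))) p b))
    rwa [sub_zero, ← hfold, ← map_sub] at this
  have hk : p + k + 1 = p + 1 + k := by omega
  -- Applying `μ` to both pairs gives a difference killed by `δ`, so its values on the two fibres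
  -- agree: `μ a - μ (a - b) = μ b - μ 0`.
  have hdiff := (μ.connecting hU hV hUV rfl hk he).sub (μ.connecting hU hV hUV rfl hk he')
  rw [sub_self] at hdiff
  have heq := hdiff.loop_eq
  rw [map_sub (pullback (R := S) (loopFibre X 1 _) (p + k)),
    map_sub (pullback (R := S) (loopFibre X (-1) _) (p + k)), (μ.pullback_op_loop c).1,
    (μ.pullback_op_loop c).2, (μ.pullback_op_loop _).1, (μ.pullback_op_loop _).2, hl, hr, hca, hcb,
    μ.op_zero, sub_zero] at heq
  rw [← heq, sub_sub_cancel]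

/-- An operation that vanishes in some degree vanishes in the preceding degree. -/
theorem op_eq_zero_of_succ {p q : ℤ} (h : p + 1 = q)
    (hq : ∀ (X : Type u) [TopologicalSpace X] (a : Cohomology R X q), μ.op X q a = 0)
    (X : Type u) [TopologicalSpace X] (a : Cohomology R X p) : μ.op X p a = 0 := by
  obtain ⟨c, hca, hcb⟩ := exists_class_sum a (0 : Cohomology R X p)
  have hU := isOpen_loopU X
  have hV := isOpen_loopV X
  have hUV := loopU_union_loopV X
  obtain ⟨e, he⟩ := IsMVConnecting.exists hU hV hUV h (pullback (loopSplit X) p c)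
  -- Here `μ e = 0` by hypothesis, so `δ` kills `μ` of the pair `(a, 0)`, and its two components `μ
  -- a` and `μ 0 = 0` coincide.
  have heq := μ.connecting hU hV hUV h (by omega) he
  rw [hq] at heq
  have := heq.loop_eq
  rwa [(μ.pullback_op_loop c).1, (μ.pullback_op_loop c).2, hca, hcb, μ.op_zero] at this

/-- An operation of excess at least `m` vanishes in degree `m - 1`. -/
theorem op_eq_zero_of_le_excess {m : ℕ} (hm : (m : ℕ∞) ≤ μ.excess) (X : Type u)
    [TopologicalSpace X] (a : Cohomology R X ((m : ℤ) - 1)) : μ.op X ((m : ℤ) - 1) a = 0 := by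
  cases m with
  | zero =>
    have : Subsingleton (Cohomology R X (((0 : ℕ) : ℤ) - 1)) := by
      have : IsEmpty (SingularSimplex X (((0 : ℕ) : ℤ) - 1)) :=
        inferInstanceAs (IsEmpty (SingularSimplex X (Int.negSucc 0)))
      have : Subsingleton (cocycles R X (((0 : ℕ) : ℤ) - 1)) := inferInstance
      exact (QuotientAddGroup.mk_surjective).subsingleton
    rw [Subsingleton.elim a 0, μ.op_zero]
  | succ m =>
    -- The excess is a supremum that may be infinite, so it only provides some degree `l ≥ m` in
    -- which `μ` vanishes; `hdesc` descends from `l` to `m`.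
    obtain ⟨l, hl, hml⟩ : ∃ l : ℕ, (∀ (X : Type u) [TopologicalSpace X] (a : Cohomology R X l),
        μ.op X l a = 0) ∧ m ≤ l := by
      by_contra! hcon
      have : μ.excess ≤ m := by
        refine sSup_le ?_
        rintro _ ⟨l, hl, rfl⟩
        have hlm : l + 1 ≤ m := hcon l hl
        change (l : ℕ∞) + 1 ≤ m
        exact_mod_cast hlm
      have hmm : m + 1 ≤ m := by exact_mod_cast hm.trans this
      omega
    have hdesc : ∀ j : ℕ, m ≤ j → (∀ (X : Type u) [TopologicalSpace X] (a : Cohomology R X j),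
        μ.op X j a = 0) → ∀ (X : Type u) [TopologicalSpace X] (a : Cohomology R X m),
        μ.op X m a = 0 := by
      intro j hj
      induction j, hj using Nat.le_induction with
      | base => exact fun h => h
      | succ j _ ih => exact fun h => ih (μ.op_eq_zero_of_succ (by push_cast; rfl) h)
    have hcast : ((m + 1 : ℕ) : ℤ) - 1 = m := by push_cast; ring
    generalize ((m + 1 : ℕ) : ℤ) - 1 = p at a hcast
    subst hcast
    exact hdesc l hml hl X a

/-- A class of degree `m` that vanishes on both members of an open cover is annihilated by
operations of excess at least `m`. -/
theorem op_eq_zero_of_cover {m : ℕ} (hm : (m : ℕ∞) ≤ μ.excess) {Y : Type u} [TopologicalSpace Y]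
    {U V : Set Y} (hU : IsOpen U) (hV : IsOpen V) (hUV : U ∪ V = Set.univ) {a : Cohomology R Y m}
    (haU : pullback (incl U) m a = 0) (haV : pullback (incl V) m a = 0) : μ.op Y m a = 0 := by
  obtain ⟨e, he⟩ := IsMVConnecting.exists_of_restrict (sub_add_cancel (m : ℤ) 1) haU haV
  have := μ.connecting hU hV hUV _ (by omega) he
  rw [μ.op_eq_zero_of_le_excess hm] at this
  exact this.eq_zero hU hV hUV

end StableOperation

/-! ### Covers from the genus -/

theorem exists_cover_of_genus_le_two {E B : Type*} [TopologicalSpace E] [TopologicalSpace B]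
    {p : C(E, B)} (h : genus p ≤ 2) : ∃ U V : Set B, IsOpen U ∧ IsOpen V ∧ U ∪ V = Set.univ ∧
      (∃ s : C(U, E), ∀ b : U, p (s b) = b) ∧ ∃ s : C(V, E), ∀ b : V, p (s b) = b := by
  have hne : ((fun k : ℕ => (k : ℕ∞)) ''
      {k : ℕ | ∃ U : Fin k → Set B, (∀ i, IsOpen (U i)) ∧ (⋃ i, U i) = Set.univ ∧
        ∀ i, ∃ s : C(U i, E), ∀ b : U i, p (s b) = b}).Nonempty := by
    by_contra hcon
    rw [Set.not_nonempty_iff_eq_empty] at hcon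
    rw [genus, hcon, sInf_empty] at h
    exact absurd h (by decide)
  obtain ⟨k, ⟨W, hW, hcov, hs⟩, hk⟩ := csInf_mem hne
  have hk2 : k ≤ 2 := by
    have hk' : (k : ℕ∞) ≤ 2 := hk.le.trans h
    exact_mod_cast hk'
  -- Covers with fewer than two members are padded with the empty set, which always has a section.
  have hempty : ∃ s : C((∅ : Set B), E), ∀ b : (∅ : Set B), p (s b) = b :=
    ⟨⟨fun b => b.2.elim, continuous_of_const fun b => b.2.elim⟩, fun b => b.2.elim⟩
  interval_cases k
  · refine ⟨∅, ∅, isOpen_empty, isOpen_empty, ?_, hempty, hempty⟩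
    rw [← hcov]
    simp
  · refine ⟨W 0, ∅, hW 0, isOpen_empty, ?_, hs 0, hempty⟩
    rw [← hcov, Set.union_empty]
    ext b
    simp [Fin.exists_fin_one]
  · refine ⟨W 0, W 1, hW 0, hW 1, ?_, hs 0, hs 1⟩
    rw [← hcov]
    ext b
    simp [Fin.exists_fin_two]

/-- Zero-divisors vanish where the pulled back path fibration has a section. -/
theorem pullback_zeroDivisor_eq_zero {R : Type*} [AddCommGroup R] {X Y : Type*}
    [TopologicalSpace X] [TopologicalSpace Y] {n : ℕ} (i j : Fin n) {m : ℤ} (v : Cohomology R X m)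
    (f : C(Y, Fin n → X)) {U : Set Y}
    (hs : ∃ s : C(U, {z : Y × C(unitInterval, X) // f z.1 = pathFibration X n z.2}),
      ∀ b : U, pullbackMap (pathFibration X n) f (s b) = b) :
    pullback (incl U) m (pullback f m (zeroDivisor i j v)) = 0 := by
  obtain ⟨s, hs⟩ := hs
  rw [zeroDivisor, map_sub, map_sub, ← pullback_comp, ← pullback_comp, ← pullback_comp,
    ← pullback_comp, sub_eq_zero]
  have hn : ∀ i : Fin n, (i : ℝ) / ((n : ℝ) - 1) ∈ unitInterval := fun i => by
    have hi : (i : ℝ) + 1 ≤ n := by exact_mod_cast i.2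
    have h0 : (0 : ℝ) ≤ (i : ℕ) := Nat.cast_nonneg _
    exact ⟨div_nonneg h0 (by linarith), div_le_one_of_le₀ (by linarith) (by linarith)⟩
  have hval : ∀ (b : U) (l : Fin n), (s b).1.2 ⟨_, hn l⟩ = f b l := fun b l => by
    have h1 : (s b).1.1 = b := hs b
    have h2 := congrFun (s b).2 l
    rw [h1] at h2
    exact h2.symm
  -- The evaluation time moves linearly from the `j`-th to the `i`-th node, so evaluating the paths
  -- of the section at `H` is the required homotopy.
  let H : unitInterval → unitInterval := fun t =>
    ⟨(1 - (t : ℝ)) * ((j : ℝ) / ((n : ℝ) - 1)) + t * ((i : ℝ) / ((n : ℝ) - 1)),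
      (convex_Icc (0 : ℝ) 1) (hn j) (hn i) (by linarith [t.2.2]) t.2.1 (by ring)⟩
  have hH : Continuous H := by
    refine Continuous.subtype_mk ?_ _
    fun_prop
  refine pullback_eq_of_homotopy ⟨fun z => (s z.1).1.2 (H z.2), ?_⟩ ?_ ?_ m v
  · have h1 : Continuous fun z : U × unitInterval => (s z.1).1.2 := by fun_prop
    exact h1.eval (hH.comp continuous_snd)
  · intro b
    refine (congrArg (s b).1.2 (Subtype.ext ?_)).trans (hval b j)
    change (1 - (0 : ℝ)) * _ + 0 * _ = _
    ring
  · intro b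
    refine (congrArg (s b).1.2 (Subtype.ext ?_)).trans (hval b i)
    change (1 - (1 : ℝ)) * _ + 1 * _ = _
    ring

end TCWeight

end

theorem theorem4p3 {R : Type v} [AddCommGroup R] {S : Type w} [AddCommGroup S] {k : ℤ}
    (μ : TCWeight.StableOperation.{u} R S k) (m : ℕ) (hm : (m : ℕ∞) ≤ μ.excess)
    (X : Type u) [TopologicalSpace X] (n : ℕ) (hn : 2 ≤ n) (v : TCWeight.Cohomology R X m)
    (i j : Fin n) :
    μ.op (Fin n → X) m (TCWeight.zeroDivisor i j v) =
        TCWeight.zeroDivisor i j (μ.op X m v) ∧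
      2 ≤ TCWeight.wgt (TCWeight.pathFibration X n)
        (μ.op (Fin n → X) m (TCWeight.zeroDivisor i j v)) := by
  constructor
  · rw [TCWeight.zeroDivisor, μ.op_sub, μ.natural, μ.natural]
    rfl
  · refine le_sSup ⟨2, fun Y _ f hf => ?_, rfl⟩
    obtain ⟨U, V, hU, hV, hUV, hsU, hsV⟩ := TCWeight.exists_cover_of_genus_le_two hf
    -- Naturality moves the pullback inside `μ`, so only the vanishing of the zero-divisor on the
    -- two open sets is needed.
    rw [← μ.natural]
    exact μ.op_eq_zero_of_cover hm hU hV hUV (TCWeight.pullback_zeroDivisor_eq_zero i j v f hsU)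
      (TCWeight.pullback_zeroDivisor_eq_zero i j v f hsV)
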